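/- Let $\Bbbk$ be an algebraically closed field of characteristic $0$, and let $Q=(Q_0,Q_1)$ be a finite quiver (loops and multiple arrows allowed) whose underlying graph is connected, with incidence matrix $M$, where $M_{ij}$ is the number of arrows from $i$ to $j$. Let $\Bbbk Q$ be its path algebra, with paths composed from left to right and graded by path length, and let $e_i$ be the trivial path at the vertex $i$. Let $\sigma$ be a $\Bbbk$-algebra automorphism of $\Bbbk Q$ with $\sigma(e_i)=e_i$ for every vertex $i$, and let $\omega\in\Bbbk Q$ be a $\sigma$-twisted superpotential of degree $s\ge 3$, i.e. $\omega$ is homogeneous of degree $s$ and is invariant under the linear map $a_1a_2\cdots a_s\mapsto \sigma(a_s)a_1\cdots a_{s-1}$. For $a\in Q_1$ let $\partial_a$ be the linear map on $\Bbbk Q$ with $\partial_a(aq)=q$ for every path $q$ that starts at the head of $a$, and $\partial_a(p)=0$ for every path $p$ that does not begin with $a$. Put $A=\Bbbk Q/(\partial_a\omega : a\in Q_1)$, with matrix-valued Hilbert series $h_A(t)=\sum_{n\ge 0}H_nt^n$, $(H_n)_{ij}=\dim_\Bbbk e_iA_ne_j$. Suppose that $Q_1=S_1\sqcup S_2$ with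 $S_1,S_2$ nonempty and disjoint, such that every $s$-cycle (closed path of length $s$) of $Q$ has all of its arrows in $S_1$ or all of its arrows in $S_2$. Then: 1. for some $n\le s$, the coefficients of $t^n$ in $h_A(t)$ and in $(I-Mt+M^{T}t^{s-1}-It^s)^{-1}$ are different; 2. $A$ is not twisted Calabi-Yau of dimension $3$. Here, with $A^e=A\otimes_\Bbbk A^{\mathrm{op}}$, an algebra $A$ is twisted Calabi-Yau of dimension $d$ if the left $A^e$-module $A$ has a resolution of finite length by finitely generated projective $A^e$-modules, $\operatorname{Ext}^i_{A^e}(A,A^e)=0$ for $i\ne d$, and $\operatorname{Ext}^d_{A^e}(A,A^e)\cong U$ as right $A^e$-modules for some invertible $(A,A)$-bimodule $U$. -/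

import Mathlib

open CategoryTheory TensorProduct

noncomputable section

universe u

set_option linter.unusedSectionVars false

/-! ### The path algebra of a finite quiver -/

/-- The path algebra `kQ`, decomposed as `⨁_{i,j} e_i kQ e_j`: the component at `(i, j)` is the
vector space with basis the paths from `i` to `j`. -/
def PathAlgebra (k V : Type*) [Field k] [Quiver V] : Type _ :=
  ∀ i j : V, (Quiver.Path i j →₀ k)

namespace PathAlgebra

section Module

variable (k V : Type*) [Field k] [Quiver V]

instance : AddCommGroup (PathAlgebra k V) :=
  inferInstanceAs (AddCommGroup (∀ i j : V, (Quiver.Path i j →₀ k)))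

instance : Module k (PathAlgebra k V) :=
  inferInstanceAs (Module k (∀ i j : V, (Quiver.Path i j →₀ k)))

variable {V}

/-- Concatenation of paths (from left to right), extended bilinearly. -/
def concat (i l j : V) :
    (Quiver.Path i l →₀ k) →ₗ[k] (Quiver.Path l j →₀ k) →ₗ[k] (Quiver.Path i j →₀ k) :=
  Finsupp.linearCombination k fun p => Finsupp.lmapDomain k k p.comp

theorem concat_single {i l j : V} (p : Quiver.Path i l) (q : Quiver.Path l j) (c d : k) :
    concat k i l j (Finsupp.single p c) (Finsupp.single q d) =
      Finsupp.single (p.comp q) (c * d) := by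
  simp [concat, Finsupp.mapDomain_single]

theorem concat_assoc {h i l j : V} (x : Quiver.Path h i →₀ k) (y : Quiver.Path i l →₀ k)
    (z : Quiver.Path l j →₀ k) :
    concat k h l j (concat k h i l x y) z = concat k h i j x (concat k i l j y z) := by
  induction x using Finsupp.induction_linear with
  | zero => simp
  | add x x' hx hx' => simp [hx, hx']
  | single p a =>
    induction y using Finsupp.induction_linear with
    | zero => simp
    | add y y' hy hy' => simp [hy, hy']
    | single q b =>
      induction z using Finsupp.induction_linear with
      | zero => simp
      | add z z' hz hz' => simp [hz, hz']
      | single r c => simp only [concat_single, mul_assoc, Quiver.Path.comp_assoc]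

theorem nil_concat {i j : V} (x : Quiver.Path i j →₀ k) :
    concat k i i j (Finsupp.single Quiver.Path.nil 1) x = x := by
  induction x using Finsupp.induction_linear with
  | zero => simp
  | add x x' hx hx' => simp [hx, hx']
  | single p a => simp [concat_single]

theorem concat_nil {i j : V} (x : Quiver.Path i j →₀ k) :
    concat k i j j x (Finsupp.single Quiver.Path.nil 1) = x := by
  induction x using Finsupp.induction_linear with
  | zero => simp
  | add x x' hx hx' => simp [hx, hx']
  | single p a => simp [concat_single]

end Module

section Algebra

variable (k V : Type*) [Field k] [Quiver V] [Fintype V] [DecidableEq V]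

instance : Mul (PathAlgebra k V) where
  mul f g := fun i j => ∑ l, concat k i l j (f i l) (g l j)

instance : One (PathAlgebra k V) where
  one := fun i => Pi.single i (Finsupp.single Quiver.Path.nil 1)

variable {k V}

theorem mul_apply (f g : PathAlgebra k V) (i j : V) :
    (f * g) i j = ∑ l, concat k i l j (f i l) (g l j) := rfl

theorem one_apply_self (i : V) :
    (1 : PathAlgebra k V) i i = Finsupp.single Quiver.Path.nil 1 :=
  Pi.single_eq_same (M := fun j => Quiver.Path i j →₀ k) i _

theorem one_apply_ne {i j : V} (h : j ≠ i) : (1 : PathAlgebra k V) i j = 0 :=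
  Pi.single_eq_of_ne (M := fun j => Quiver.Path i j →₀ k) h _

theorem add_apply (f g : PathAlgebra k V) (i j : V) : (f + g) i j = f i j + g i j := rfl

theorem zero_apply (i j : V) : (0 : PathAlgebra k V) i j = 0 := rfl

theorem smul_apply (c : k) (f : PathAlgebra k V) (i j : V) : (c • f) i j = c • f i j := rfl

instance : Ring (PathAlgebra k V) where
  __ := (inferInstance : AddCommGroup (PathAlgebra k V))
  left_distrib f g h := by
    funext i j
    simp [mul_apply, add_apply, Finset.sum_add_distrib]
  right_distrib f g h := by
    funext i j
    simp [mul_apply, add_apply, Finset.sum_add_distrib]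
  zero_mul f := by
    funext i j
    simp [mul_apply, zero_apply]
  mul_zero f := by
    funext i j
    simp [mul_apply, zero_apply]
  mul_assoc f g h := by
    funext i j
    simp only [mul_apply, map_sum, LinearMap.sum_apply, concat_assoc]
    exact Finset.sum_comm
  one_mul f := by
    funext i j
    rw [mul_apply, Finset.sum_eq_single i]
    · rw [one_apply_self, nil_concat]
    · intro l _ hl
      rw [one_apply_ne hl]
      simp
    · simp
  mul_one f := by
    funext i j
    rw [mul_apply, Finset.sum_eq_single j]
    · rw [one_apply_self, concat_nil]
    · intro l _ hl
      rw [one_apply_ne hl.symm]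
      simp
    · simp

instance : Algebra k (PathAlgebra k V) :=
  Algebra.ofModule
    (fun c f g => by
      funext i j
      simp [mul_apply, smul_apply, Finset.smul_sum])
    (fun c f g => by
      funext i j
      simp [mul_apply, smul_apply, Finset.smul_sum])

variable (k)

/-- A path, as an element of `kQ`. -/
def ofPath {i j : V} (p : Quiver.Path i j) : PathAlgebra k V :=
  (Pi.single i (Pi.single j (Finsupp.single p 1)) : ∀ i j : V, (Quiver.Path i j →₀ k))

/-- The trivial path `e_i`. -/
def idem (i : V) : PathAlgebra k V := ofPath k (Quiver.Path.nil : Quiver.Path i i)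

/-- The `k`-linear map on `kQ` with prescribed values on paths. -/
def extendLinearly {W : Type*} [AddCommGroup W] [Module k W]
    (F : ∀ i j : V, Quiver.Path i j → W) : PathAlgebra k V →ₗ[k] W where
  toFun f := ∑ i, ∑ j, Finsupp.linearCombination k (F i j) (f i j)
  map_add' f g := by simp [add_apply, Finset.sum_add_distrib]
  map_smul' c f := by simp [smul_apply, Finset.smul_sum]

variable (V) in
/-- `kQ_n`, the span of the paths of length `n`. -/
def gradedPart (n : ℕ) : Submodule k (PathAlgebra k V) :=
  Submodule.span k {x | ∃ (i j : V) (p : Quiver.Path i j), p.length = n ∧ x = ofPath k p}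

open Classical in
/-- `∂_a` on a path: `∂_a (a q) = q`, and `∂_a p = 0` if `p` does not begin with `a`. -/
def derivPath (a : Quiver.Total V) (i j : V) (p : Quiver.Path i j) : PathAlgebra k V :=
  if h : ∃ q : Quiver.Path a.right j,
      (⟨i, p⟩ : Σ v : V, Quiver.Path v j) = ⟨a.left, a.hom.toPath.comp q⟩ then
    ofPath k h.choose
  else 0

/-- The derivation operator `∂_a` on `kQ`. -/
def deriv (a : Quiver.Total V) : PathAlgebra k V →ₗ[k] PathAlgebra k V :=
  extendLinearly k (derivPath k a)

variable {k}

/-- The path `a_1 ⋯ a_d`, `d ≥ 1`, is sent to `σ(a_d) a_1 ⋯ a_{d-1}`; trivial paths are fixed. -/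
def rotatePath (σ : PathAlgebra k V ≃ₐ[k] PathAlgebra k V) (i : V) :
    ∀ j : V, Quiver.Path i j → PathAlgebra k V
  | _, .nil => idem k i
  | _, .cons p a => σ (ofPath k a.toPath) * ofPath k p

/-- The linear map `a_1 ⋯ a_d ↦ σ(a_d) a_1 ⋯ a_{d-1}` on `kQ`. -/
def rotate (σ : PathAlgebra k V ≃ₐ[k] PathAlgebra k V) : PathAlgebra k V →ₗ[k] PathAlgebra k V :=
  extendLinearly k (rotatePath σ)

/-- `ω` is a `σ`-twisted superpotential of degree `d`. -/
def IsTwistedSuperpotential (σ : PathAlgebra k V ≃ₐ[k] PathAlgebra k V) (d : ℕ)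
    (ω : PathAlgebra k V) : Prop :=
  ω ∈ gradedPart k V d ∧ rotate σ ω = ω

/-! ### Quotients of the path algebra and their Hilbert series -/

/-- The two-sided ideal `(∂_a ω : a ∈ Q_1)`. -/
def derivIdeal (ω : PathAlgebra k V) : TwoSidedIdeal (PathAlgebra k V) :=
  TwoSidedIdeal.span (Set.range fun a : Quiver.Total V => deriv k a ω)

/-- The matrix-valued Hilbert series `∑ H_n t^n` of `A = kQ/I`, with
`(H_n)_{ij} = dim_k e_i A_n e_j` and `A_n` the image of `kQ_n`. -/
def hilbertSeries (I : TwoSidedIdeal (PathAlgebra k V)) : PowerSeries (Matrix V V ℤ) :=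
  PowerSeries.mk fun n => Matrix.of fun i j =>
    (Module.finrank k
      (((gradedPart k V n).map (I.ringCon.mkₐ k).toLinearMap).map
        (LinearMap.mulLeftRight k (I.ringCon.mk' (idem k i), I.ringCon.mk' (idem k j)))) : ℤ)

/-- The derivation-quotient algebra `kQ/(∂_a ω : a ∈ Q_1)`. -/
abbrev DerivationQuotient (ω : PathAlgebra k V) : Type _ := (derivIdeal ω).ringCon.Quotient

end Algebra

end PathAlgebra

/-- The sequence of arrows of a path. -/
def Quiver.Path.arrowList {V : Type*} [Quiver V] {i : V} :
    ∀ {j : V}, Quiver.Path i j → List (Quiver.Total V)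
  | _, .nil => []
  | _, .cons p a => p.arrowList ++ [⟨_, _, a⟩]

/-- The incidence matrix: `M_{ij}` is the number of arrows from `i` to `j`. -/
def incidenceMatrix (V : Type*) [Quiver V] [∀ i j : V, Fintype (i ⟶ j)] : Matrix V V ℤ :=
  Matrix.of fun i j => (Fintype.card (i ⟶ j) : ℤ)

section Series

variable {V : Type*} [Fintype V] [DecidableEq V]

/-- `I - M t + Mᵀ t^{s-1} - I t^s`. -/
def typePolynomial (M : Matrix V V ℤ) (s : ℕ) : PowerSeries (Matrix V V ℤ) :=
  1 - PowerSeries.C M * PowerSeries.X + PowerSeries.C M.transpose * PowerSeries.X ^ (s - 1)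
    - PowerSeries.X ^ s

/-- `(I - M t + Mᵀ t^{s-1} - I t^s)⁻¹`, for `s ≥ 2`. -/
def typeSeries (M : Matrix V V ℤ) (s : ℕ) : PowerSeries (Matrix V V ℤ) :=
  PowerSeries.invOfUnit (typePolynomial M s) 1

theorem constantCoeff_typePolynomial (M : Matrix V V ℤ) {s : ℕ} (hs : 2 ≤ s) :
    PowerSeries.constantCoeff (typePolynomial M s) = 1 := by
  have h1 : s - 1 ≠ 0 := by omega
  have h2 : s ≠ 0 := by omega
  simp [typePolynomial, h1, h2]

/-- `typeSeries` is a right inverse of `typePolynomial`. -/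
theorem typePolynomial_mul_typeSeries (M : Matrix V V ℤ) {s : ℕ} (hs : 2 ≤ s) :
    typePolynomial M s * typeSeries M s = 1 :=
  PowerSeries.mul_invOfUnit _ _ (by simp [constantCoeff_typePolynomial M hs])

/-- `typeSeries` is a left inverse of `typePolynomial`. -/
theorem typeSeries_mul_typePolynomial (M : Matrix V V ℤ) {s : ℕ} (hs : 2 ≤ s) :
    typeSeries M s * typePolynomial M s = 1 :=
  PowerSeries.invOfUnit_mul _ _ (by simp [constantCoeff_typePolynomial M hs])

end Series

/-! ### Twisted Calabi-Yau algebras -/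

namespace TwistedCY

variable (k : Type*) [Field k] (A : Type u) [Ring A] [Algebra k A]

/-- The enveloping algebra `A ⊗ Aᵒᵖ`; left modules over it are `(A, A)`-bimodules. -/
abbrev Env : Type u := A ⊗[k] Aᵐᵒᵖ

/-- `A` as a left module over its enveloping algebra: `(a ⊗ b) • x = a x b`. -/
def diagonal : ModuleCat.{u} (Env k A) :=
  letI : Module (Env k A) A := TensorProduct.Algebra.module
  ModuleCat.of (Env k A) A

/-- The enveloping algebra as a left module over itself. -/
def free : ModuleCat.{u} (Env k A) := ModuleCat.of (Env k A) (Env k A)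

/-- Right multiplication by `x`, an endomorphism of the left module `A^e`. -/
def rightMul (x : Env k A) : free k A ⟶ free k A :=
  ModuleCat.ofHom (LinearMap.toSpanSingleton (Env k A) (Env k A) x)

variable {k A}

/-- The left action of `A` on a bimodule. -/
def lact {U : ModuleCat.{u} (Env k A)} (a : A) (x : U) : U :=
  (a ⊗ₜ[k] MulOpposite.op (1 : A) : Env k A) • x

/-- The right action of `A` on a bimodule. -/
def ract {U : ModuleCat.{u} (Env k A)} (x : U) (a : A) : U :=
  ((1 : A) ⊗ₜ[k] MulOpposite.op a : Env k A) • x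

/-- The subgroup of `U ⊗_ℤ W` generated by the elements `u a ⊗ w - u ⊗ a w`. -/
def balancingSubgroup (U W : ModuleCat.{u} (Env k A)) : AddSubgroup (U ⊗[ℤ] W) :=
  AddSubgroup.closure
    {t | ∃ (x : U) (a : A) (w : W), t = ract x a ⊗ₜ[ℤ] w - x ⊗ₜ[ℤ] lact a w}

/-- The tensor product `U ⊗_A W` of two bimodules. -/
abbrev TensorOver (U W : ModuleCat.{u} (Env k A)) : Type u :=
  (U ⊗[ℤ] W) ⧸ balancingSubgroup U W

/-- The class of `u ⊗ w` in `U ⊗_A W`. -/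
def tmul {U W : ModuleCat.{u} (Env k A)} (x : U) (w : W) : TensorOver U W :=
  QuotientAddGroup.mk (x ⊗ₜ[ℤ] w)

/-- `U ⊗_A W ≅ A` as `(A, A)`-bimodules. -/
def TensorIsoDiagonal (U W : ModuleCat.{u} (Env k A)) : Prop :=
  ∃ ψ : TensorOver U W ≃+ A, ∀ (a b : A) (x : U) (w : W),
    ψ (tmul (lact a x) (ract w b)) = a * ψ (tmul x w) * b

/-- The `(A, A)`-bimodule `U` is invertible. -/
def IsInvertible (U : ModuleCat.{u} (Env k A)) : Prop :=
  ∃ W : ModuleCat.{u} (Env k A), TensorIsoDiagonal U W ∧ TensorIsoDiagonal W U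

variable (k A)

/-- `A` has a resolution of finite length by finitely generated projective bimodules. -/
def IsHomologicallySmooth : Prop :=
  ∃ P : ProjectiveResolution (diagonal k A),
    (∀ n, Module.Finite (Env k A) (P.complex.X n)) ∧
      ∃ N, ∀ n, N < n → Limits.IsZero (P.complex.X n)

/-- `Ext^i_{A^e}(A, A^e)`. -/
abbrev ExtEnv (i : ℕ) : Type u := Abelian.Ext.{u} (diagonal k A) (free k A) i

variable {k A} in
/-- The right action of `A^e` on `Ext^i_{A^e}(A, A^e)`, induced by right multiplication on the
second argument. -/
def extAct {i : ℕ} (ξ : ExtEnv k A i) (x : Env k A) : ExtEnv k A i :=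
  ξ.comp (Abelian.Ext.mk₀ (rightMul k A x)) (add_zero i)

/-- `A` is twisted Calabi-Yau of dimension `d`. A bimodule `U` is a right `A^e`-module through
`u · (a ⊗ b) = b u a`. -/
def IsTwistedCalabiYau (d : ℕ) : Prop :=
  IsHomologicallySmooth k A ∧
    (∀ i, i ≠ d → Subsingleton (ExtEnv k A i)) ∧
      ∃ U : ModuleCat.{u} (Env k A), IsInvertible U ∧
        ∃ φ : ExtEnv k A d ≃+ U, ∀ (ξ : ExtEnv k A d) (a b : A),
          φ (extAct ξ (a ⊗ₜ[k] MulOpposite.op b)) = lact b (ract (φ ξ) a)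

end TwistedCY

end

/-!
Fix a partition of the arrows into `S` and its complement such that every closed path of length `s`
lies on one side. Write `M` for the incidence matrix. Since `σ` fixes the trivial paths, a rotated
element is a combination of closed paths (`rotate_apply_ne`), so `ω` is one, and it is the sum of an
`S`-part and a part supported outside `S`. As the quiver is connected, some vertex `i` is incident
with an arrow in `S` and with an arrow outside `S` (`Quiver.exists_incident_mem_and_notMem`). The
derivation ideal lies in `R + (Q₁ R + R Q₁) + kQ_{>s}`, where `R` is the span of the `∂_a ω`, which
are homogeneous of degree `s - 1 ≥ 2` (`apply_mem_lowDegreeBound`).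

**The Hilbert series.** The expected series has coefficients `M ^ (s - 1) - Mᵀ` and
`M ^ s - (M Mᵀ + Mᵀ M) + 1` in degrees `s - 1` and `s`. If the first one is correct, the `∂_a ω` are
linearly independent, because `Mᵀ` counts them (`linearIndependent_relation`). Write `ω = ∑ ω_b b`.
Twisted invariance makes each `∂_a ω` a combination of the `ω_b`
(`relation_eq_sum_rightQuot`; `σ` need not be graded, only its linear part matters), so by
independence the `ω_b` form another basis of `R`. If the coefficient in degree `s` is correct as well,
the products `a ∂_b ω` and `∂_b ω a` in `e_i kQ e_i`, of which there are `(M Mᵀ + Mᵀ M)_{ii}`, satisfy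
at most one linear relation (`finrank_ker_relationMul_le`). But each of the two parts of `ω` gives a
relation `∑ a ∂_a ω = ∑ ω_b b`, the sums being over the arrows on one side
(`exists_mem_ker_relationMul`), and at `i` these two relations are independent (`false_of_outgoing`).

**The Calabi-Yau property.** Already `Ext¹(A, A^e)` is nonzero. Consider the derivation of `kQ` into
`A^e` that agrees with the commutator with `ξ = e_i ⊗ e_i` on the arrows in `S` and vanishes on the
other arrows (`partialInner`). The paths of `∂_a ω` all lie on the side of `a`, so that the derivation
kills `∂_a ω` and descends to `A`. If `Ext¹(A, A^e)` vanished, it would be the commutator with some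
`η` (`exists_eq_commutator_mul`). Then `η - ξ` would commute with the arrows in `S`, and `η` with
those outside `S`. An element that commutes with an arrow at `i` has coefficient `0` at `e_i ⊗ e_i`,
as one sees by comparing coefficients of arrows, so `ξ` would have coefficient `0` there as well,
whereas it is `1`.
-/

noncomputable section

set_option linter.unusedSectionVars false

/-! ### Factorizations of paths -/

namespace Quiver.Path

variable {V : Type*} [Quiver V]

/-- Two factorizations of a path whose second factors have equal lengths coincide; unlike in
`Quiver.Path.comp_inj`, the middle vertices are not assumed to agree. -/
theorem sigma_eq_of_comp_eq_comp {i l l' j : V} {p : Path i l} {q : Path l j} {p' : Path i l'}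
    {q' : Path l' j} (h : p.comp q = p'.comp q') (hlen : q.length = q'.length) :
    (⟨l, p, q⟩ : Σ v, Path i v × Path v j) = ⟨l', p', q'⟩ := by
  induction q with
  | nil =>
    cases q' with
    | nil => simp only [comp_nil] at h; rw [h]
    | cons q' a => simp at hlen
  | cons q a ih =>
    cases q' with
    | nil => simp at hlen
    | cons q' a' =>
      simp only [comp_cons, cons.injEq] at h
      obtain ⟨rfl, h1, h2⟩ := h
      have := ih (eq_of_heq h1) (by simpa using hlen)
      cases this
      rw [eq_of_heq h2]

/-- A path has at most one first arrow. -/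
theorem sigma_eq_of_toPath_comp_eq {i l l' j : V} {a : i ⟶ l} {q : Path l j} {a' : i ⟶ l'}
    {q' : Path l' j} (h : a.toPath.comp q = a'.toPath.comp q') :
    (⟨l, a, q⟩ : Σ v, (i ⟶ v) × Path v j) = ⟨l', a', q'⟩ := by
  have hl : q.length = q'.length := by
    have := congrArg length h
    simpa using this
  have := sigma_eq_of_comp_eq_comp h hl
  rw [Sigma.mk.injEq] at this
  obtain ⟨rfl, h2⟩ := this
  have h3 := eq_of_heq h2
  rw [Prod.mk.injEq] at h3
  have h4 : a = a' := by
    have := h3.1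
    simp only [Hom.toPath, cons.injEq, heq_eq_eq, true_and] at this
    exact this
  rw [h4, h3.2]

theorem arrowList_comp {i l j : V} (p : Path i l) (q : Path l j) :
    (p.comp q).arrowList = p.arrowList ++ q.arrowList := by
  induction q with
  | nil => simp [arrowList]
  | cons q a ih => simp [arrowList, ih]

theorem arrowList_toPath {i j : V} (a : i ⟶ j) :
    a.toPath.arrowList = [(⟨i, j, a⟩ : Quiver.Total V)] := by
  simp [Hom.toPath, arrowList]

end Quiver.Path

/-! ### Components of the path algebra -/

namespace PathAlgebra

open Classical

variable {k V : Type*} [Field k] [Quiver V]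

section Components

variable [Fintype V] [DecidableEq V]

variable (k) in
/-- The inclusion of the component `e_i kQ e_j` into `kQ`. -/
def single (i j : V) : (Quiver.Path i j →₀ k) →ₗ[k] PathAlgebra k V where
  toFun x := (Pi.single i (Pi.single j x) : ∀ i j : V, (Quiver.Path i j →₀ k))
  map_add' x y := by
    refine Eq.trans ?_ (Pi.single_add (f := fun i => ∀ j : V, (Quiver.Path i j →₀ k)) i _ _)
    congr 1
    exact Pi.single_add (f := fun j => (Quiver.Path i j →₀ k)) j _ _
  map_smul' c x := by
    refine Eq.trans ?_ (Pi.single_smul (f := fun i => ∀ j : V, (Quiver.Path i j →₀ k)) i c _)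
    congr 1
    exact Pi.single_smul (f := fun j => (Quiver.Path i j →₀ k)) j _ _

theorem single_same (i j : V) (x : Quiver.Path i j →₀ k) : single k i j x i j = x := by
  change (Pi.single i (Pi.single j x) : ∀ i j : V, (Quiver.Path i j →₀ k)) i j = x
  rw [Pi.single_eq_same, Pi.single_eq_same]

theorem single_ne {i j i' j' : V} (h : ¬ (i' = i ∧ j' = j)) (x : Quiver.Path i j →₀ k) :
    single k i j x i' j' = 0 := by
  change (Pi.single i (Pi.single j x) : ∀ i j : V, (Quiver.Path i j →₀ k)) i' j' = 0
  by_cases hi : i' = i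
  · subst hi
    rw [Pi.single_eq_same, Pi.single_eq_of_ne (fun hj => h ⟨rfl, hj⟩)]
  · rw [Pi.single_eq_of_ne hi]; rfl

theorem ofPath_eq_single {i j : V} (p : Quiver.Path i j) :
    ofPath k p = single k i j (Finsupp.single p 1) := rfl

theorem sum_apply {ι : Type*} (s : Finset ι) (f : ι → PathAlgebra k V) (i j : V) :
    (∑ x ∈ s, f x) i j = ∑ x ∈ s, f x i j := by
  induction s using Finset.induction_on with
  | empty => simp [zero_apply]
  | insert a s ha ih => rw [Finset.sum_insert ha, Finset.sum_insert ha, add_apply, ih]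

theorem sum_single (x : PathAlgebra k V) : ∑ i, ∑ j, single k i j (x i j) = x := by
  funext i j
  rw [sum_apply, Finset.sum_eq_single i, sum_apply, Finset.sum_eq_single j]
  · exact single_same i j _
  · intro j' _ hj
    exact single_ne (fun h => hj h.2.symm) _
  · simp
  · intro i' _ hi
    rw [sum_apply]
    exact Finset.sum_eq_zero fun j' _ => single_ne (fun h => hi h.1.symm) _
  · simp

theorem ofPath_induction {P : PathAlgebra k V → Prop} (x : PathAlgebra k V) (zero : P 0)
    (add : ∀ x y, P x → P y → P (x + y)) (smul : ∀ (c : k) x, P x → P (c • x))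
    (path : ∀ (i j : V) (p : Quiver.Path i j), P (ofPath k p)) : P x := by
  have hsum : ∀ (s : Finset V) (f : V → PathAlgebra k V), (∀ i, P (f i)) → P (∑ i ∈ s, f i) := by
    intro s f hf
    induction s using Finset.induction_on with
    | empty => simpa using zero
    | insert a s ha ih => rw [Finset.sum_insert ha]; exact add _ _ (hf a) ih
  rw [← sum_single x]
  refine hsum _ _ fun i => hsum _ _ fun j => ?_
  induction x i j using Finsupp.induction_linear with
  | zero => simpa using zero
  | add y z hy hz => rw [map_add]; exact add _ _ hy hz
  | single p c =>
    have : single k i j (Finsupp.single p c) = c • ofPath k p := by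
      rw [ofPath_eq_single, ← map_smul, Finsupp.smul_single, smul_eq_mul, mul_one]
    rw [this]
    exact smul _ _ (path i j p)

theorem linearMap_ext {W : Type*} [AddCommGroup W] [Module k W] {f g : PathAlgebra k V →ₗ[k] W}
    (h : ∀ (i j : V) (p : Quiver.Path i j), f (ofPath k p) = g (ofPath k p)) (x : PathAlgebra k V) :
    f x = g x := by
  induction x using ofPath_induction with
  | zero => simp
  | add x y hx hy => simp [hx, hy]
  | smul c x hx => simp [hx]
  | path i j p => exact h i j p

theorem ofPath_apply_self {i j : V} (p : Quiver.Path i j) :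
    ofPath k p i j = Finsupp.single p 1 := single_same i j _

theorem ofPath_apply_ne {i j i' j' : V} (h : ¬ (i' = i ∧ j' = j)) (p : Quiver.Path i j) :
    ofPath k p i' j' = 0 := single_ne h _

theorem ofPath_apply {i j i' j' : V} (p : Quiver.Path i j) (q : Quiver.Path i' j') :
    ofPath k p i' j' q =
      if (⟨i, j, p⟩ : Σ a b : V, Quiver.Path a b) = ⟨i', j', q⟩ then 1 else 0 := by
  by_cases h : i' = i ∧ j' = j
  · obtain ⟨rfl, rfl⟩ := h
    rw [ofPath_apply_self, Finsupp.single_apply]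
    simp
  · rw [ofPath_apply_ne h, if_neg]
    · rfl
    · intro h'
      cases h'
      exact h ⟨rfl, rfl⟩

theorem single_mul_single {i l j : V} (x : Quiver.Path i l →₀ k) (y : Quiver.Path l j →₀ k) :
    single k i l x * single k l j y = single k i j (concat k i l j x y) := by
  funext i' j'
  rw [mul_apply]
  by_cases h : i' = i ∧ j' = j
  · obtain ⟨rfl, rfl⟩ := h
    rw [Finset.sum_eq_single l, single_same, single_same, single_same]
    · intro m _ hm
      rw [single_ne (fun h => hm h.2), map_zero]; rfl
    · simp
  · rw [single_ne h]
    refine Finset.sum_eq_zero fun m _ => ?_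
    by_cases hi : i' = i
    · rw [single_ne (i := l) (fun hh => h ⟨hi, hh.2⟩), map_zero]
    · rw [single_ne (i := i) (fun hh => hi hh.1), map_zero]; rfl

theorem single_mul_single_ne {i l l' j : V} (h : l ≠ l') (x : Quiver.Path i l →₀ k)
    (y : Quiver.Path l' j →₀ k) : single k i l x * single k l' j y = 0 := by
  funext i' j'
  rw [mul_apply]
  refine Finset.sum_eq_zero fun m _ => ?_
  by_cases hi : m = l
  · rw [single_ne (i := l') (fun hh => h (hi.symm.trans hh.1)), map_zero]
  · rw [single_ne (i := i) (fun hh => hi hh.2), map_zero]; rfl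

theorem ofPath_mul_ofPath {i l j : V} (p : Quiver.Path i l) (q : Quiver.Path l j) :
    ofPath k p * ofPath k q = ofPath k (p.comp q) := by
  simp only [ofPath_eq_single, single_mul_single, concat_single, mul_one]

theorem ofPath_mul_ofPath_ne {i l l' j : V} (h : l ≠ l') (p : Quiver.Path i l)
    (q : Quiver.Path l' j) : ofPath k p * ofPath k q = 0 :=
  single_mul_single_ne h _ _

theorem idem_mul_ofPath {i j : V} (p : Quiver.Path i j) : idem k i * ofPath k p = ofPath k p := by
  rw [idem, ofPath_mul_ofPath, Quiver.Path.nil_comp]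

theorem ofPath_mul_idem {i j : V} (p : Quiver.Path i j) : ofPath k p * idem k j = ofPath k p := by
  rw [idem, ofPath_mul_ofPath, Quiver.Path.comp_nil]

/-- `e_i x e_j` is the `(i, j)` component of `x`. -/
theorem idem_mul_mul_idem (i j : V) (x : PathAlgebra k V) :
    idem k i * x * idem k j = single k i j (x i j) := by
  induction x using ofPath_induction with
  | zero => rw [mul_zero, zero_mul, zero_apply, map_zero]
  | add x y hx hy => rw [mul_add, add_mul, hx, hy, add_apply, map_add]
  | smul c x hx => rw [mul_smul_comm, smul_mul_assoc, hx, smul_apply, map_smul]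
  | path i' j' p =>
    by_cases hi : i = i'
    · subst hi
      rw [idem_mul_ofPath]
      by_cases hj : j' = j
      · subst hj
        rw [ofPath_mul_idem, ofPath_apply_self, ofPath_eq_single]
      · rw [idem, ofPath_mul_ofPath_ne hj, ofPath_apply_ne (fun h => hj h.2.symm), map_zero]
    · rw [idem, ofPath_mul_ofPath_ne hi, zero_mul, ofPath_apply_ne (fun h => hi h.1), map_zero]

theorem extendLinearly_single {W : Type*} [AddCommGroup W] [Module k W]
    (F : ∀ i j : V, Quiver.Path i j → W) (i j : V) (x : Quiver.Path i j →₀ k) :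
    extendLinearly k F (single k i j x) = Finsupp.linearCombination k (F i j) x := by
  change ∑ i', ∑ j', Finsupp.linearCombination k (F i' j') (single k i j x i' j') = _
  rw [Finset.sum_eq_single i, Finset.sum_eq_single j, single_same]
  · intro j' _ hj
    rw [single_ne (fun h => hj h.2), map_zero]
  · simp
  · intro i' _ hi
    exact Finset.sum_eq_zero fun j' _ => by rw [single_ne (fun h => hi h.1), map_zero]
  · simp

theorem extendLinearly_ofPath {W : Type*} [AddCommGroup W] [Module k W]
    (F : ∀ i j : V, Quiver.Path i j → W) {i j : V} (p : Quiver.Path i j) :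
    extendLinearly k F (ofPath k p) = F i j p := by
  rw [ofPath_eq_single, extendLinearly_single, Finsupp.linearCombination_single, one_smul]

variable (k) in
/-- The coefficient of the path `p`, as a linear functional on `kQ`. -/
def coeffPath {i j : V} (p : Quiver.Path i j) : PathAlgebra k V →ₗ[k] k where
  toFun x := x i j p
  map_add' _ _ := rfl
  map_smul' _ _ := rfl

/-- The coefficients of `f p'` at paths of the form `t q` with `q` as long as `p'`. -/
theorem mul_ofPath_apply_comp {u l j m n : V} (f : PathAlgebra k V) (p' : Quiver.Path u l)
    (t : Quiver.Path j m) (q : Quiver.Path m n) (hlen : p'.length = q.length) :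
    (f * ofPath k p') j n (t.comp q) =
      if (⟨u, l, p'⟩ : Σ a b : V, Quiver.Path a b) = ⟨m, n, q⟩ then f j m t else 0 := by
  induction f using ofPath_induction with
  | zero => rw [zero_mul]; simp [zero_apply]
  | add x y hx hy =>
    rw [add_mul, add_apply, Finsupp.add_apply, hx, hy]; split_ifs <;> simp [add_apply]
  | smul c x hx =>
    rw [smul_mul_assoc, smul_apply, Finsupp.smul_apply, hx]; split_ifs <;> simp [smul_apply]
  | path α β r =>
    by_cases hβ : β = u
    · subst hβ
      rw [ofPath_mul_ofPath, ofPath_apply, ofPath_apply]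
      by_cases h : (⟨α, l, r.comp p'⟩ : Σ a b : V, Quiver.Path a b) = ⟨j, n, t.comp q⟩
      · rw [if_pos h]
        rw [Sigma.mk.injEq] at h
        obtain ⟨rfl, h⟩ := h
        replace h := eq_of_heq h
        rw [Sigma.mk.injEq] at h
        obtain ⟨rfl, h⟩ := h
        cases Quiver.Path.sigma_eq_of_comp_eq_comp (eq_of_heq h) hlen
        simp
      · rw [if_neg h]
        split_ifs with h1 h2
        · cases h1; cases h2; exact absurd rfl h
        · rfl
        · rfl
    · rw [ofPath_mul_ofPath_ne hβ, ofPath_apply]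
      split_ifs with h1 h2
      · cases h1; cases h2; exact absurd rfl hβ
      · rfl
      · rfl

/-- `∂_a` of a path that begins with `a`. -/
theorem derivPath_toPath_comp {i l j : V} (a : i ⟶ l) (q : Quiver.Path l j) :
    derivPath k ⟨i, l, a⟩ i j (a.toPath.comp q) = ofPath k q := by
  have h : ∃ q' : Quiver.Path l j, (⟨i, a.toPath.comp q⟩ : Σ v : V, Quiver.Path v j) =
      ⟨i, a.toPath.comp q'⟩ := ⟨q, rfl⟩
  have h2 : h.choose = q := by
    have := h.choose_spec
    rw [Sigma.mk.injEq] at this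
    exact ((Quiver.Path.comp_inj_right).1 (eq_of_heq this.2)).symm
  rw [derivPath, dif_pos h]
  exact congrArg (ofPath k) h2

/-- The coefficients of `∂_a x`. -/
theorem deriv_apply {i l j : V} (a : i ⟶ l) (x : PathAlgebra k V) (q : Quiver.Path l j) :
    deriv k ⟨i, l, a⟩ x l j q = x i j (a.toPath.comp q) := by
  refine linearMap_ext (f := coeffPath k q ∘ₗ deriv k ⟨i, l, a⟩) (g := coeffPath k _)
    (fun u w p => ?_) x
  change deriv k ⟨i, l, a⟩ (ofPath k p) l j q = ofPath k p i j (a.toPath.comp q)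
  rw [deriv, extendLinearly_ofPath, ofPath_apply]
  split_ifs with h
  · cases h
    rw [derivPath_toPath_comp, ofPath_apply_self, Finsupp.single_eq_same]
  · rw [derivPath]
    split_ifs with h'
    · rw [ofPath_apply, if_neg]
      intro h2
      apply h
      rw [Sigma.mk.injEq] at h2
      obtain ⟨-, h2⟩ := h2
      replace h2 := eq_of_heq h2
      rw [Sigma.mk.injEq] at h2
      obtain ⟨rfl, h2⟩ := h2
      have := h'.choose_spec
      rw [eq_of_heq h2] at this
      cases this
      rfl
    · rfl

theorem deriv_apply_ne {i l m j : V} (a : i ⟶ l) (x : PathAlgebra k V) (h : m ≠ l) :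
    deriv k ⟨i, l, a⟩ x m j = 0 := by
  ext q
  refine linearMap_ext (f := coeffPath k q ∘ₗ deriv k ⟨i, l, a⟩) (g := 0) (fun u w p => ?_) x
  change deriv k ⟨i, l, a⟩ (ofPath k p) m j q = 0
  rw [deriv, extendLinearly_ofPath, derivPath]
  split_ifs with h'
  · rw [ofPath_apply_ne (fun hh => h hh.1)]; rfl
  · rfl

end Components

end PathAlgebra

namespace PathAlgebra

open Classical

variable {k V : Type*} [Field k] [Quiver V] [Fintype V] [DecidableEq V]

/-! ### The coefficients of a twisted superpotential -/

/-- The elements of `e_i kQ e_j` all of whose paths have their length in `N`. -/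
def lengthIn (k : Type*) [Field k] (N : Set ℕ) (i j : V) : Submodule k (Quiver.Path i j →₀ k) :=
  Finsupp.supported k k {p | p.length ∈ N}

theorem mem_lengthIn {N : Set ℕ} {i j : V} {x : Quiver.Path i j →₀ k} :
    x ∈ lengthIn k N i j ↔ ∀ p, x p ≠ 0 → p.length ∈ N := by
  rw [lengthIn, Finsupp.mem_supported]
  simp [Set.subset_def]

theorem lengthIn_disjoint {M N : Set ℕ} (h : Disjoint M N) {i j : V} {x : Quiver.Path i j →₀ k}
    (h1 : x ∈ lengthIn k M i j) (h2 : x ∈ lengthIn k N i j) : x = 0 := by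
  ext p
  by_contra hp
  exact Set.disjoint_left.1 h (mem_lengthIn.1 h1 p hp) (mem_lengthIn.1 h2 p hp)

theorem apply_mem_lengthIn {n : ℕ} {x : PathAlgebra k V} (hx : x ∈ gradedPart k V n) (i j : V) :
    x i j ∈ lengthIn k {n} i j := by
  induction hx using Submodule.span_induction with
  | mem x hx =>
    obtain ⟨u, w, p, hp, rfl⟩ := hx
    rw [mem_lengthIn]
    intro q hq
    rw [ofPath_apply] at hq
    have h : (⟨u, w, p⟩ : Σ a b : V, Quiver.Path a b) = ⟨i, j, q⟩ := by
      by_contra h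
      exact hq (if_neg h)
    cases h
    exact hp
  | zero => exact Submodule.zero_mem _
  | add x y _ _ hx hy => exact Submodule.add_mem _ hx hy
  | smul c x _ hx => exact Submodule.smul_mem _ c hx

theorem single_mem_gradedPart {n : ℕ} {i j : V} {x : Quiver.Path i j →₀ k}
    (hx : x ∈ lengthIn k {n} i j) : single k i j x ∈ gradedPart k V n := by
  rw [lengthIn, Finsupp.supported_eq_span_single] at hx
  induction hx using Submodule.span_induction with
  | mem x hx =>
    obtain ⟨p, hp, rfl⟩ := hx
    exact Submodule.subset_span ⟨i, j, p, hp, rfl⟩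
  | zero => rw [map_zero]; exact Submodule.zero_mem _
  | add x y _ _ hx hy => rw [map_add]; exact Submodule.add_mem _ hx hy
  | smul c x _ hx => rw [map_smul]; exact Submodule.smul_mem _ c hx

section Superpotential

variable {σ : PathAlgebra k V ≃ₐ[k] PathAlgebra k V}

/-- An automorphism that fixes the trivial paths preserves each `e_i kQ e_j`. -/
theorem apply_automorphism_ofPath_ne (hσ : ∀ i : V, σ (idem k i) = idem k i) {i j i' j' : V}
    (h : ¬ (i' = i ∧ j' = j)) (p : Quiver.Path i j) : σ (ofPath k p) i' j' = 0 := by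
  have h1 : σ (ofPath k p) = single k i j (σ (ofPath k p) i j) := by
    rw [← idem_mul_mul_idem, ← hσ i, ← hσ j, ← map_mul, ← map_mul, idem_mul_ofPath,
      ofPath_mul_idem]
  rw [h1, single_ne h]

/-- A rotated element is a combination of closed paths: `σ(a_s)` ends where `a_s` does, and this
has to be the vertex at which `a_1` starts. -/
theorem rotate_apply_ne (hσ : ∀ i : V, σ (idem k i) = idem k i) (x : PathAlgebra k V) {i j : V}
    (h : i ≠ j) : rotate σ x i j = 0 := by
  ext q
  refine linearMap_ext (f := coeffPath k q ∘ₗ rotate σ) (g := 0) (fun u w p => ?_) x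
  change rotate σ (ofPath k p) i j q = 0
  rw [rotate, extendLinearly_ofPath]
  cases p with
  | nil =>
    rw [rotatePath, idem, ofPath_apply_ne (fun hh => h (hh.1.trans hh.2.symm))]; rfl
  | @cons l _ p a =>
    rw [rotatePath, mul_apply, Finset.sum_eq_zero]
    · rfl
    intro m _
    by_cases hm : m = u ∧ j = l
    · rw [apply_automorphism_ofPath_ne hσ, map_zero]
      · rfl
      · rintro ⟨h1, h2⟩
        exact h (h1.trans hm.2.symm)
    · rw [ofPath_apply_ne hm, map_zero]

/-- The coefficient of `a q` in a rotated element. -/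
theorem rotate_apply_toPath_comp [∀ i j : V, Fintype (i ⟶ j)]
    (hσ : ∀ i : V, σ (idem k i) = idem k i) {s : ℕ}
    {x : PathAlgebra k V} (hx : x ∈ gradedPart k V s) {i j : V} (a : j ⟶ i) (q : Quiver.Path i j)
    (hq : q.length + 1 = s) :
    rotate σ x j j (a.toPath.comp q) =
      ∑ b : j ⟶ i, σ (ofPath k b.toPath) j i a.toPath * x i i (q.cons b) := by
  induction hx using Submodule.span_induction with
  | zero => rw [map_zero]; simp [zero_apply]
  | add x y _ _ hx hy =>
    rw [map_add, add_apply, Finsupp.add_apply, hx, hy, ← Finset.sum_add_distrib]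
    simp [add_apply, mul_add]
  | smul c x _ hx =>
    rw [map_smul, smul_apply, Finsupp.smul_apply, hx, Finset.smul_sum]
    simp only [smul_apply, Finsupp.smul_apply, smul_eq_mul]
    exact Finset.sum_congr rfl fun b _ => by ring
  | mem x hx =>
    obtain ⟨u, w, p, hp, rfl⟩ := hx
    rw [rotate, extendLinearly_ofPath]
    cases p with
    | nil => simp at hp; omega
    | @cons l _ p c =>
      have hlen : p.length = q.length := by simp at hp; omega
      rw [rotatePath, mul_ofPath_apply_comp _ _ _ _ hlen]
      by_cases h : (⟨u, l, p⟩ : Σ a b : V, Quiver.Path a b) = ⟨i, j, q⟩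
      · cases h
        rw [if_pos rfl]
        by_cases hw : w = i
        · subst hw
          rw [Finset.sum_eq_single c]
          · rw [ofPath_apply, if_pos rfl, mul_one]
          · intro b _ hb
            rw [ofPath_apply, if_neg, mul_zero]
            intro h
            simp at h
            exact hb h.symm
          · simp
        · rw [apply_automorphism_ofPath_ne hσ (fun hh => hw hh.2.symm)]
          refine (Finset.sum_eq_zero fun b _ => ?_).symm
          rw [ofPath_apply_ne (fun hh => hw hh.2.symm)]
          exact mul_zero _
      · rw [if_neg h]
        refine (Finset.sum_eq_zero fun b _ => ?_).symm
        rw [ofPath_apply, if_neg, mul_zero]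
        intro hh
        apply h
        cases hh
        rfl

end Superpotential

/-- For an arrow `a`, the element `y` such that the paths beginning with `a` contribute `a y` to
`x`. -/
def leftQuot {i j m : V} (a : j ⟶ i) (x : Quiver.Path j m →₀ k) : Quiver.Path i m →₀ k :=
  x.comapDomain a.toPath.comp (Quiver.Path.comp_injective_right _).injOn

/-- For an arrow `b`, the element `y` such that the paths ending with `b` contribute `y b` to
`x`. -/
def rightQuot {i j m : V} (b : j ⟶ i) (x : Quiver.Path m i →₀ k) : Quiver.Path m j →₀ k :=
  x.comapDomain (fun q => q.comp b.toPath) (Quiver.Path.comp_injective_left _).injOn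

theorem leftQuot_apply {i j m : V} (a : j ⟶ i) (x : Quiver.Path j m →₀ k) (q : Quiver.Path i m) :
    leftQuot a x q = x (a.toPath.comp q) := rfl

theorem rightQuot_apply {i j m : V} (b : j ⟶ i) (x : Quiver.Path m i →₀ k) (q : Quiver.Path m j) :
    rightQuot b x q = x (q.cons b) := rfl

theorem leftQuot_mem_lengthIn {n : ℕ} {i j m : V} (a : j ⟶ i) {x : Quiver.Path j m →₀ k}
    (hx : x ∈ lengthIn k {n} j m) : leftQuot a x ∈ lengthIn k {n - 1} i m := by
  rw [mem_lengthIn] at hx ⊢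
  intro p hp
  have := hx _ hp
  simp at this ⊢
  omega

theorem concat_single_apply_comp {i l j : V} (p : Quiver.Path i l) (x : Quiver.Path l j →₀ k)
    (q : Quiver.Path l j) :
    concat k i l j (Finsupp.single p 1) x (p.comp q) = x q := by
  simp only [concat, Finsupp.linearCombination_single, one_smul, Finsupp.lmapDomain_apply]
  exact Finsupp.mapDomain_apply (Quiver.Path.comp_injective_right p) x q

theorem concat_single_apply_of_forall_ne {i l j : V} (p : Quiver.Path i l)
    (x : Quiver.Path l j →₀ k) (r : Quiver.Path i j) (h : ∀ q, r ≠ p.comp q) :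
    concat k i l j (Finsupp.single p 1) x r = 0 := by
  simp only [concat, Finsupp.linearCombination_single, one_smul, Finsupp.lmapDomain_apply]
  exact Finsupp.mapDomain_of_notMem_range x r (fun ⟨q, hq⟩ => h q hq.symm)

theorem concat_right_single {i l j : V} (x : Quiver.Path i l →₀ k) (p : Quiver.Path l j) :
    concat k i l j x (Finsupp.single p 1) = x.mapDomain (fun q => q.comp p) := by
  induction x using Finsupp.induction_linear with
  | zero => simp
  | add x y hx hy => simp [hx, hy, Finsupp.mapDomain_add]
  | single q c => rw [concat_single, mul_one, Finsupp.mapDomain_single]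

theorem concat_right_single_apply_comp {i l j : V} (x : Quiver.Path i l →₀ k)
    (p : Quiver.Path l j) (q : Quiver.Path i l) :
    concat k i l j x (Finsupp.single p 1) (q.comp p) = x q := by
  rw [concat_right_single]
  exact Finsupp.mapDomain_apply (Quiver.Path.comp_injective_left p) x q

theorem concat_right_single_apply_of_forall_ne {i l j : V} (x : Quiver.Path i l →₀ k)
    (p : Quiver.Path l j) (r : Quiver.Path i j) (h : ∀ q : Quiver.Path i l, r ≠ q.comp p) :
    concat k i l j x (Finsupp.single p 1) r = 0 := by
  rw [concat_right_single]
  exact Finsupp.mapDomain_of_notMem_range x r (fun ⟨q, hq⟩ => h q hq.symm)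

theorem concat_mem_lengthIn {M N P : Set ℕ} (h : ∀ m ∈ M, ∀ n ∈ N, m + n ∈ P) {i l j : V}
    {x : Quiver.Path i l →₀ k} {y : Quiver.Path l j →₀ k} (hx : x ∈ lengthIn k M i l)
    (hy : y ∈ lengthIn k N l j) : concat k i l j x y ∈ lengthIn k P i j := by
  rw [lengthIn, Finsupp.supported_eq_span_single] at hx hy
  induction hx using Submodule.span_induction with
  | zero => rw [map_zero]; exact Submodule.zero_mem _
  | add x x' _ _ hx hx' => rw [map_add]; exact Submodule.add_mem _ hx hx'
  | smul c x _ hx => rw [map_smul]; exact Submodule.smul_mem _ c hx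
  | mem x hx =>
    obtain ⟨p, hp, rfl⟩ := hx
    induction hy using Submodule.span_induction with
    | zero => rw [map_zero]; exact Submodule.zero_mem _
    | add x x' _ _ hx hx' => rw [map_add]; exact Submodule.add_mem _ hx hx'
    | smul c x _ hx => rw [map_smul]; exact Submodule.smul_mem _ c hx
    | mem y hy =>
      obtain ⟨q, hq, rfl⟩ := hy
      rw [concat_single, lengthIn]
      refine Finsupp.single_mem_supported k _ ?_
      simp only [Set.mem_ofPred_eq, Quiver.Path.length_comp]
      exact h _ hp _ hq

theorem toPath_mem_lengthIn {i j : V} (a : i ⟶ j) :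
    Finsupp.single a.toPath (1 : k) ∈ lengthIn k {1} i j :=
  Finsupp.single_mem_supported k _ rfl

/-! ### The derivation ideal in low degrees -/

section Ideal

variable (ω : PathAlgebra k V)

/-- `∂_a ω`, for an arrow `a : j ⟶ i`, as an element of `e_i kQ e_j`. -/
def relation {i j : V} (a : j ⟶ i) : Quiver.Path i j →₀ k := leftQuot a (ω j j)

/-- The products `a ∂_b ω` and `∂_b ω a` with an arrow `a` that lie in `e_i kQ e_j`. -/
def relationMul (i j : V) :
    (Σ l, (i ⟶ l) × (j ⟶ l)) ⊕ (Σ l, (l ⟶ i) × (l ⟶ j)) → (Quiver.Path i j →₀ k)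
  | .inl ⟨l, a, b⟩ => concat k i l j (Finsupp.single a.toPath 1) (relation ω b)
  | .inr ⟨l, b, a⟩ => concat k i l j (relation ω b) (Finsupp.single a.toPath 1)

/-- The `(i, j)` component of `R + (Q₁ R + R Q₁) + kQ_{>s}`, where `R` is the span of the
`∂_a ω`. -/
def lowDegreeBound (s : ℕ) (i j : V) : Submodule k (Quiver.Path i j →₀ k) :=
  Submodule.span k (Set.range fun a : j ⟶ i => relation ω a) ⊔
    Submodule.span k (Set.range (relationMul ω i j)) ⊔ lengthIn k (Set.Ioi s) i j

variable {ω} {s : ℕ} (hω : ω ∈ gradedPart k V s)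

include hω

theorem relation_mem_lengthIn {i j : V} (a : j ⟶ i) :
    relation ω a ∈ lengthIn k {s - 1} i j :=
  leftQuot_mem_lengthIn a (apply_mem_lengthIn hω j j)

theorem relationMul_mem_lengthIn (hs : 3 ≤ s) {i j : V} (x) :
    relationMul ω i j x ∈ lengthIn k {s} i j := by
  have h1 : 1 + (s - 1) = s := by omega
  rcases x with ⟨l, a, b⟩ | ⟨l, b, a⟩
  · exact concat_mem_lengthIn (by simp [h1]) (toPath_mem_lengthIn _)
      (relation_mem_lengthIn hω b)
  · exact concat_mem_lengthIn (by simp; omega) (relation_mem_lengthIn hω b)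
      (toPath_mem_lengthIn _)

theorem span_relation_le {i j : V} :
    Submodule.span k (Set.range fun a : j ⟶ i => relation ω a) ≤ lengthIn k {s - 1} i j := by
  rw [Submodule.span_le]
  rintro _ ⟨a, rfl⟩
  exact relation_mem_lengthIn hω a

theorem span_relationMul_le (hs : 3 ≤ s) {i j : V} :
    Submodule.span k (Set.range (relationMul ω i j)) ≤ lengthIn k {s} i j := by
  rw [Submodule.span_le]
  rintro _ ⟨a, rfl⟩
  exact relationMul_mem_lengthIn hω hs a

theorem concat_toPath_mem_lowDegreeBound (hs : 3 ≤ s) {i l j : V} (a : i ⟶ l)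
    {x : Quiver.Path l j →₀ k} (hx : x ∈ lowDegreeBound ω s l j) :
    concat k i l j (Finsupp.single a.toPath 1) x ∈ lowDegreeBound ω s i j := by
  have key : lowDegreeBound ω s l j ≤ (lowDegreeBound ω s i j).comap
      (concat k i l j (Finsupp.single a.toPath 1)) := by
    refine sup_le (sup_le ?_ ?_) ?_
    · rw [Submodule.span_le]
      rintro _ ⟨b, rfl⟩
      refine Submodule.mem_sup_left (Submodule.mem_sup_right (Submodule.subset_span ?_))
      exact ⟨.inl ⟨l, a, b⟩, rfl⟩
    · refine (span_relationMul_le hω hs).trans fun y hy => Submodule.mem_sup_right ?_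
      exact concat_mem_lengthIn (by simp) (toPath_mem_lengthIn _) hy
    · refine fun y hy => Submodule.mem_sup_right ?_
      exact concat_mem_lengthIn (by simp; omega) (toPath_mem_lengthIn _) hy
  exact key hx

theorem concat_right_toPath_mem_lowDegreeBound (hs : 3 ≤ s) {i l j : V} (a : l ⟶ j)
    {x : Quiver.Path i l →₀ k} (hx : x ∈ lowDegreeBound ω s i l) :
    concat k i l j x (Finsupp.single a.toPath 1) ∈ lowDegreeBound ω s i j := by
  have key : lowDegreeBound ω s i l ≤ (lowDegreeBound ω s i j).comap
      ((concat k i l j).flip (Finsupp.single a.toPath 1)) := by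
    refine sup_le (sup_le ?_ ?_) ?_
    · rw [Submodule.span_le]
      rintro _ ⟨b, rfl⟩
      refine Submodule.mem_sup_left (Submodule.mem_sup_right (Submodule.subset_span ?_))
      exact ⟨.inr ⟨l, b, a⟩, rfl⟩
    · refine (span_relationMul_le hω hs).trans fun y hy => Submodule.mem_sup_right ?_
      exact concat_mem_lengthIn (by simp) hy (toPath_mem_lengthIn _)
    · refine fun y hy => Submodule.mem_sup_right ?_
      exact concat_mem_lengthIn (by simp; omega) hy (toPath_mem_lengthIn _)
  exact key hx

theorem concat_mem_lowDegreeBound (hs : 3 ≤ s) {i l j : V} (y : Quiver.Path i l →₀ k)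
    {x : Quiver.Path l j →₀ k} (hx : x ∈ lowDegreeBound ω s l j) :
    concat k i l j y x ∈ lowDegreeBound ω s i j := by
  induction y using Finsupp.induction_linear with
  | zero => rw [map_zero]; exact Submodule.zero_mem _
  | add y z hy hz => rw [map_add]; exact Submodule.add_mem _ hy hz
  | single p c =>
    have : Finsupp.single p c = c • Finsupp.single p (1 : k) := by simp
    rw [this, map_smul, LinearMap.smul_apply]
    refine Submodule.smul_mem _ _ ?_
    induction p with
    | nil => rwa [nil_concat]
    | cons p a ih =>
      have h2 : Finsupp.single (p.cons a) (1 : k) =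
          concat k _ _ _ (Finsupp.single p 1) (Finsupp.single a.toPath 1) := by
        rw [concat_single, mul_one]; rfl
      rw [h2, concat_assoc]
      exact ih (concat_toPath_mem_lowDegreeBound hω hs a hx) (by simp)

theorem concat_right_mem_lowDegreeBound (hs : 3 ≤ s) {i l j : V} (y : Quiver.Path l j →₀ k)
    {x : Quiver.Path i l →₀ k} (hx : x ∈ lowDegreeBound ω s i l) :
    concat k i l j x y ∈ lowDegreeBound ω s i j := by
  induction y using Finsupp.induction_linear with
  | zero => rw [map_zero]; exact Submodule.zero_mem _
  | add y z hy hz => rw [map_add]; exact Submodule.add_mem _ hy hz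
  | single p c =>
    have : Finsupp.single p c = c • Finsupp.single p (1 : k) := by simp
    rw [this, map_smul]
    refine Submodule.smul_mem _ _ ?_
    clear this
    induction p with
    | nil => rwa [concat_nil]
    | cons p a ih =>
      have h2 : Finsupp.single (p.cons a) (1 : k) =
          concat k _ _ _ (Finsupp.single p 1) (Finsupp.single a.toPath 1) := by
        rw [concat_single, mul_one]; rfl
      rw [h2, ← concat_assoc]
      exact concat_right_toPath_mem_lowDegreeBound hω hs a ih

omit hω in
/-- If `ω` is a combination of closed paths, `∂_a ω` has a single component. -/
theorem deriv_eq_single (hdiag : ∀ i j : V, i ≠ j → ω i j = 0) {i j : V} (a : j ⟶ i) :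
    deriv k ⟨j, i, a⟩ ω = single k i j (relation ω a) := by
  funext m n
  by_cases hm : m = i
  · subst hm
    ext q
    rw [deriv_apply]
    by_cases hn : n = j
    · subst hn
      rw [single_same]; rfl
    · rw [single_ne (fun h => hn h.2), hdiag _ _ (Ne.symm hn)]; rfl
  · rw [deriv_apply_ne _ _ hm, single_ne (fun h => hm h.1)]

/-- The derivation ideal is contained in `R + (Q₁ R + R Q₁) + kQ_{>s}`, since this is a two-sided
ideal. -/
theorem apply_mem_lowDegreeBound (hs : 3 ≤ s) (hdiag : ∀ i j : V, i ≠ j → ω i j = 0)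
    {x : PathAlgebra k V} (hx : x ∈ derivIdeal ω) (i j : V) :
    x i j ∈ lowDegreeBound ω s i j := by
  let T : TwoSidedIdeal (PathAlgebra k V) := TwoSidedIdeal.mk'
    {x | ∀ i j, x i j ∈ lowDegreeBound ω s i j}
    (fun i j => Submodule.zero_mem _)
    (fun hx hy i j => Submodule.add_mem _ (hx i j) (hy i j))
    (fun hx i j => Submodule.neg_mem _ (hx i j))
    (fun {x y} hy i j => by
      rw [mul_apply]
      exact Submodule.sum_mem _ fun l _ => concat_mem_lowDegreeBound hω hs _ (hy l j))
    (fun {x y} hx i j => by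
      rw [mul_apply]
      exact Submodule.sum_mem _ fun l _ => concat_right_mem_lowDegreeBound hω hs _ (hx i l))
  have hT : ∀ y, y ∈ T ↔ ∀ i j, y i j ∈ lowDegreeBound ω s i j := fun y =>
    TwoSidedIdeal.mem_mk' _ _ _ _ _ _ _
  have hle : derivIdeal ω ≤ T := by
    rw [derivIdeal, TwoSidedIdeal.span_le]
    rintro _ ⟨⟨j, i, a⟩, rfl⟩
    refine (hT _).2 fun m n => ?_
    change deriv k ⟨j, i, a⟩ ω m n ∈ _
    rw [deriv_eq_single hdiag]
    by_cases h : m = i ∧ n = j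
    · obtain ⟨rfl, rfl⟩ := h
      rw [single_same]
      exact Submodule.mem_sup_left (Submodule.mem_sup_left (Submodule.subset_span ⟨a, rfl⟩))
    · rw [single_ne h]
      exact Submodule.zero_mem _
  exact (hT x).1 (hle hx) i j

/-- In degree `s - 1` the derivation ideal is spanned by the `∂_a ω`. -/
theorem mem_span_relation (hs : 3 ≤ s) {i j : V} {x : Quiver.Path i j →₀ k}
    (hx : x ∈ lowDegreeBound ω s i j) (hlen : x ∈ lengthIn k {s - 1} i j) :
    x ∈ Submodule.span k (Set.range fun a : j ⟶ i => relation ω a) := by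
  obtain ⟨y, hy, h, hh, rfl⟩ := Submodule.mem_sup.1 hx
  obtain ⟨r, hr, n, hn, rfl⟩ := Submodule.mem_sup.1 hy
  have h0 : n + h = 0 := by
    refine lengthIn_disjoint (M := {s - 1}) (N := Set.Ici s) ?_ ?_ ?_
    · simp; omega
    · have := Submodule.sub_mem _ hlen (span_relation_le hω hr)
      rwa [add_assoc, add_sub_cancel_left] at this
    · refine Submodule.add_mem _ ?_ ?_
      · exact Finsupp.supported_mono (fun p hp => by simp at hp ⊢; omega)
          (span_relationMul_le hω hs hn)
      · exact Finsupp.supported_mono (fun p hp => by simp at hp ⊢; omega) hh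
  rwa [add_assoc, h0, add_zero]

/-- In degree `s` the derivation ideal is spanned by the products of the `∂_a ω` with arrows. -/
theorem mem_span_relationMul (hs : 3 ≤ s) {i j : V} {x : Quiver.Path i j →₀ k}
    (hx : x ∈ lowDegreeBound ω s i j) (hlen : x ∈ lengthIn k {s} i j) :
    x ∈ Submodule.span k (Set.range (relationMul ω i j)) := by
  obtain ⟨y, hy, h, hh, rfl⟩ := Submodule.mem_sup.1 hx
  obtain ⟨r, hr, n, hn, rfl⟩ := Submodule.mem_sup.1 hy
  have h0 : r + h = 0 := by
    refine lengthIn_disjoint (M := {s}) (N := {s}ᶜ) disjoint_compl_right ?_ ?_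
    · have := Submodule.sub_mem _ hlen (span_relationMul_le hω hs hn)
      rwa [show r + n + h - n = r + h by abel] at this
    · refine Submodule.add_mem _ ?_ ?_
      · exact Finsupp.supported_mono (fun p hp => by simp at hp ⊢; omega)
          (span_relation_le hω hr)
      · exact Finsupp.supported_mono (fun p hp => by simp at hp ⊢; omega) hh
  rwa [show r + n + h = n + (r + h) by abel, h0, add_zero]

/-- The derivation ideal vanishes in degrees below `s - 1`. -/
theorem apply_eq_zero_of_mem_lowDegreeBound (hs : 3 ≤ s) {i j : V} {x : Quiver.Path i j →₀ k}
    (hx : x ∈ lowDegreeBound ω s i j) (p : Quiver.Path i j) (hp : p.length < s - 1) :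
    x p = 0 := by
  have hle : lowDegreeBound ω s i j ≤ lengthIn k (Set.Ici (s - 1)) i j := by
    refine sup_le (sup_le ?_ ?_) ?_
    · exact (span_relation_le hω).trans
        (Finsupp.supported_mono fun p hp => by simp at hp ⊢; omega)
    · exact (span_relationMul_le hω hs).trans
        (Finsupp.supported_mono fun p hp => by simp at hp ⊢; omega)
    · exact Finsupp.supported_mono fun p hp => by simp at hp ⊢; omega
  by_contra h
  have := mem_lengthIn.1 (hle hx) p h
  simp at this
  omega

end Ideal

end PathAlgebra

/-! ### Derivations into the enveloping algebra -/

namespace TwistedCY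

open MulOpposite

universe u

variable {k : Type*} [Field k] {A : Type u} [Ring A] [Algebra k A]

variable (k) in
/-- The element `a ⊗ 1 - 1 ⊗ a` of the enveloping algebra; multiplication by it on the left is the
commutator with `a`. -/
def commutator : A →ₗ[k] Env k A :=
  (TensorProduct.mk k A Aᵐᵒᵖ).flip (op 1) -
    TensorProduct.mk k A Aᵐᵒᵖ 1 ∘ₗ (opLinearEquiv k).toLinearMap

theorem commutator_apply (a : A) : commutator k a = a ⊗ₜ[k] op 1 - 1 ⊗ₜ[k] op a := rfl

theorem commutator_mul (a b : A) : commutator k (a * b) =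
    (a ⊗ₜ[k] op 1) * commutator k b + (1 ⊗ₜ[k] op b) * commutator k a := by
  simp only [commutator_apply, mul_sub, Algebra.TensorProduct.tmul_mul_tmul, one_mul, mul_one,
    op_mul, op_one]
  abel

/-- The augmentation `x ⊗ y ↦ x y` of the enveloping algebra. -/
def augmentation : free k A ⟶ diagonal k A :=
  ModuleCat.ofHom (X := Env k A) (Y := diagonal k A)
    (LinearMap.toSpanSingleton (Env k A) (diagonal k A) (1 : A))

theorem augmentation_tmul (x y : A) :
    (augmentation (k := k)).hom (x ⊗ₜ[k] op y : Env k A) = (x * y : A) := by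
  let _ : Module (Env k A) A := TensorProduct.Algebra.module
  change (x ⊗ₜ[k] op y : Env k A) • (1 : A) = x * y
  rw [TensorProduct.Algebra.smul_def]
  simp

/-- If `Ext¹(A, A^e)` vanishes then every derivation `A → A^e` is inner. A derivation `δ` defines an
`A^e`-linear map `∑ x ⊗ y ↦ ∑ δ(x) y` on the kernel of the augmentation `A^e → A`, and the vanishing
of `Ext¹` extends it to `A^e`. -/
theorem exists_eq_commutator_mul (h : Subsingleton (ExtEnv k A 1)) (δ : A →ₗ[k] Env k A)
    (hδ : ∀ x y, δ (x * y) = (x ⊗ₜ[k] op 1) * δ y + (1 ⊗ₜ[k] op y) * δ x) :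
    ∃ η : Env k A, ∀ a, δ a = commutator k a * η := by
  let Φ : Env k A →ₗ[k] Env k A :=
    TensorProduct.lift (LinearMap.mk₂ k (fun (x : A) (y : Aᵐᵒᵖ) => (1 ⊗ₜ[k] y : Env k A) * δ x)
      (by intros; simp [mul_add])
      (by intros; rw [map_smul]; exact Algebra.mul_smul_comm _ _ _)
      (by intros; simp [TensorProduct.tmul_add, add_mul])
      (by intros; rw [TensorProduct.tmul_smul]; exact Algebra.smul_mul_assoc _ _ _))
  have hΦ : ∀ (x : A) (y : Aᵐᵒᵖ), Φ (x ⊗ₜ y) = (1 ⊗ₜ[k] y : Env k A) * δ x := fun x y => rfl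
  let μ : Env k A →ₗ[Env k A] diagonal k A := (augmentation (k := k) (A := A)).hom
  have hμ : ∀ x y : A, μ (x ⊗ₜ[k] op y) = (x * y : A) := augmentation_tmul
  obtain ⟨m, hm⟩ : ∃ m : Env k A → A, ∀ t, μ t = m t := ⟨fun t => μ t, fun t => rfl⟩
  have hm_zero : m 0 = 0 := (hm 0).symm.trans (map_zero μ)
  have hm_add : ∀ t u, m (t + u) = m t + m u := fun t u => by
    refine (hm _).symm.trans ((map_add μ t u).trans ?_)
    exact congrArg₂ (fun x y : A => x + y) (hm t) (hm u)
  have hm_tmul : ∀ x y : A, m (x ⊗ₜ[k] op y) = x * y := fun x y => (hm _).symm.trans (hμ x y)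
  -- The defect of linearity of `Φ` is proportional to the augmentation.
  have key : ∀ (a : A) (b : Aᵐᵒᵖ) (t : Env k A), Φ ((a ⊗ₜ b) * t) =
      (a ⊗ₜ b) * Φ t + (1 ⊗ₜ b) * ((1 ⊗ₜ[k] op (m t) : Env k A) * δ a) := by
    intro a b t
    induction t using TensorProduct.induction_on with
    | zero => simp [hm_zero]
    | add t u ht hu =>
      rw [hm_add, mul_add, map_add, ht, hu, map_add, MulOpposite.op_add, TensorProduct.tmul_add]
      noncomm_ring
    | tmul x y =>
      induction y using MulOpposite.rec' with | _ y => ?_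
      induction b using MulOpposite.rec' with | _ b => ?_
      rw [hm_tmul, hΦ, Algebra.TensorProduct.tmul_mul_tmul, hΦ, hδ, mul_add]
      simp only [← mul_assoc, Algebra.TensorProduct.tmul_mul_tmul, one_mul, mul_one, op_mul, op_one]
  let Ω : Submodule (Env k A) (Env k A) := LinearMap.ker μ
  have hker : ∀ t : Env k A, t ∈ Ω → ∀ r : Env k A, Φ (r * t) = r * Φ t := by
    intro t ht r
    have h0 : m t = 0 := (hm t).symm.trans (LinearMap.mem_ker.1 ht)
    induction r using TensorProduct.induction_on with
    | zero => simp
    | add r r' hr hr' => rw [add_mul, map_add, hr, hr', add_mul]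
    | tmul a b => rw [key, h0]; simp
  let f : Ω →ₗ[Env k A] Env k A :=
    { toFun := fun t => Φ t
      map_add' := fun t u => by simp
      map_smul' := fun r t => hker t.1 t.2 r }
  let S : ShortComplex (ModuleCat.{u} (Env k A)) :=
    ShortComplex.moduleCatMkOfKerLERange (X₁ := ModuleCat.of (Env k A) Ω) (X₂ := free k A)
      (X₃ := diagonal k A) (ModuleCat.ofHom Ω.subtype) augmentation
      (by rintro _ ⟨t, rfl⟩; exact t.2)
  have hS : S.ShortExact :=
    { exact := by
        rw [ShortComplex.moduleCat_exact_iff_range_eq_ker]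
        exact Submodule.range_subtype Ω
      mono_f := (ModuleCat.mono_iff_injective _).2 Subtype.val_injective
      epi_g := (ModuleCat.epi_iff_surjective _).2 fun x =>
        ⟨((x : A) ⊗ₜ[k] op 1 : Env k A), (hμ x 1).trans (@mul_one A _ x)⟩ }
  let f' : S.X₁ ⟶ free k A := ModuleCat.ofHom f
  obtain ⟨x₂, hx₂⟩ := Abelian.Ext.contravariant_sequence_exact₁ hS (free k A)
    (Abelian.Ext.mk₀ f') (add_zero 1) (h.elim _ _)
  obtain ⟨g, rfl⟩ := (Abelian.Ext.mk₀_bijective _ _).2 x₂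
  rw [Abelian.Ext.mk₀_comp_mk₀] at hx₂
  have hg : S.f ≫ g = f' := (Abelian.Ext.mk₀_bijective _ _).1 hx₂
  let G : Env k A →ₗ[Env k A] Env k A := g.hom
  refine ⟨G 1, fun a => ?_⟩
  have hmem : commutator k a ∈ Ω := by
    have h1 : (μ (a ⊗ₜ[k] op 1) : A) = a := (hμ a 1).trans (mul_one a)
    have h2 : (μ (1 ⊗ₜ[k] op a) : A) = a := (hμ 1 a).trans (one_mul a)
    refine LinearMap.mem_ker.2 ((map_sub μ _ _).trans ?_)
    exact sub_eq_zero.2 (h1.trans h2.symm)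
  have h1 : G (commutator k a) = Φ (commutator k a) := by
    have := congrArg (fun q : S.X₁ ⟶ free k A => q.hom (⟨_, hmem⟩ : Ω)) hg
    exact this
  have h2 : δ 1 = 0 := by
    have := hδ 1 1
    rw [mul_one, show ((1 : A) ⊗ₜ[k] op (1 : A) : Env k A) = 1 from rfl] at this
    simpa using this
  have h3 : Φ (commutator k a) = δ a := by
    rw [commutator_apply, map_sub, hΦ, hΦ, h2, mul_zero, sub_zero,
      show ((1 : A) ⊗ₜ[k] op (1 : A) : Env k A) = 1 from rfl, one_mul]
  rw [← h3, ← h1, ← smul_eq_mul, ← map_smul, smul_eq_mul, mul_one]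

/-- The functional `f ⊗ g` on the enveloping algebra. -/
def tensorFunctional (f g : A →ₗ[k] k) : Env k A →ₗ[k] k :=
  LinearMap.mul' k k ∘ₗ TensorProduct.map f (g ∘ₗ (opLinearEquiv k).symm.toLinearMap)

theorem tensorFunctional_tmul (f g : A →ₗ[k] k) (x y : A) :
    tensorFunctional f g (x ⊗ₜ[k] op y) = f x * g y := rfl

theorem tensorFunctional_commutator_mul (f g : A →ₗ[k] k) (a : A) (θ : Env k A) :
    tensorFunctional f g (commutator k a * θ) =
      tensorFunctional (f ∘ₗ LinearMap.mulLeft k a) g θ -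
        tensorFunctional f (g ∘ₗ LinearMap.mulRight k a) θ := by
  induction θ using TensorProduct.induction_on with
  | zero => simp
  | add t u ht hu => rw [mul_add, map_add, ht, hu, map_add, map_add]; ring
  | tmul x y =>
    induction y using MulOpposite.rec' with | _ y => ?_
    rw [commutator_apply, sub_mul, Algebra.TensorProduct.tmul_mul_tmul,
      Algebra.TensorProduct.tmul_mul_tmul, ← op_mul, ← op_mul, map_sub]
    simp only [tensorFunctional_tmul, mul_one, one_mul, LinearMap.comp_apply,
      LinearMap.mulLeft_apply, LinearMap.mulRight_apply]

end TwistedCY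

namespace PathAlgebra

open Classical MulOpposite TwistedCY

/-! ### A derivation that sees only part of the arrows -/

section Derivation

variable {k V : Type*} [Field k] [Quiver V] [Fintype V] [DecidableEq V]
variable {A : Type*} [Ring A] [Algebra k A] (π : PathAlgebra k V →ₐ[k] A)
  (S : Set (Quiver.Total V)) (ξ : Env k A)

/-- The commutator of the arrow `a` with `ξ` if `a ∈ S`, and zero otherwise. -/
def arrowCommutator {i j : V} (a : i ⟶ j) : Env k A :=
  if (⟨i, j, a⟩ : Quiver.Total V) ∈ S then commutator k (π (ofPath k a.toPath)) * ξ else 0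

/-- The values on paths of the derivation that agrees with `[·, ξ]` on the arrows in `S` and
vanishes on the other arrows. -/
def partialInnerPath (i : V) : ∀ j : V, Quiver.Path i j → Env k A
  | _, .nil => 0
  | _, .cons p a => (π (ofPath k p) ⊗ₜ[k] op 1) * arrowCommutator π S ξ a +
      (1 ⊗ₜ[k] op (π (ofPath k a.toPath))) * partialInnerPath i _ p

/-- The derivation from the path algebra to an enveloping algebra that agrees with `[·, ξ]` on the
arrows in `S` and vanishes on the other arrows. -/
def partialInner : PathAlgebra k V →ₗ[k] Env k A :=
  extendLinearly k (partialInnerPath π S ξ)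

theorem left_mul_left (x y : A) (t : Env k A) :
    (x ⊗ₜ[k] op 1 : Env k A) * ((y ⊗ₜ[k] op 1) * t) = ((x * y) ⊗ₜ[k] op 1) * t := by
  rw [← mul_assoc, Algebra.TensorProduct.tmul_mul_tmul, op_one, mul_one]

theorem right_mul_right (x y : A) (t : Env k A) :
    (1 ⊗ₜ[k] op x : Env k A) * ((1 ⊗ₜ[k] op y) * t) = (1 ⊗ₜ[k] op (y * x)) * t := by
  rw [← mul_assoc, Algebra.TensorProduct.tmul_mul_tmul, op_mul, mul_one]

theorem left_mul_right (x y : A) (t : Env k A) :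
    (x ⊗ₜ[k] op 1 : Env k A) * ((1 ⊗ₜ[k] op y) * t) =
      (1 ⊗ₜ[k] op y) * ((x ⊗ₜ[k] op 1) * t) := by
  rw [← mul_assoc, ← mul_assoc, Algebra.TensorProduct.tmul_mul_tmul,
    Algebra.TensorProduct.tmul_mul_tmul, op_one, mul_one, mul_one, one_mul, one_mul]

theorem map_path_mul {i l j : V} (p : Quiver.Path i l) (q : Quiver.Path l j) :
    π (ofPath k p) * π (ofPath k q) = π (ofPath k (p.comp q)) := by
  rw [← map_mul, ofPath_mul_ofPath]

variable {ξ} (hξ : ∀ i, commutator k (π (idem k i)) * ξ = 0)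

include hξ

theorem right_idem_mul_arrowCommutator {i j : V} (a : i ⟶ j) :
    (1 ⊗ₜ[k] op (π (idem k j))) * arrowCommutator π S ξ a = arrowCommutator π S ξ a := by
  rw [arrowCommutator]
  split_ifs
  · conv_rhs => rw [← ofPath_mul_idem, map_mul, commutator_mul, add_mul, mul_assoc, mul_assoc, hξ,
      mul_zero, zero_add]
  · rw [mul_zero]

omit hξ in
theorem left_idem_mul_partialInnerPath {i j : V} (p : Quiver.Path i j) :
    (π (idem k i) ⊗ₜ[k] op 1) * partialInnerPath π S ξ i j p = partialInnerPath π S ξ i j p := by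
  induction p with
  | nil => simp [partialInnerPath]
  | cons p a ih =>
    rw [partialInnerPath, mul_add, left_mul_left, left_mul_right, ih, ← map_mul, idem_mul_ofPath]

theorem right_idem_mul_partialInnerPath {i j : V} (p : Quiver.Path i j) :
    (1 ⊗ₜ[k] op (π (idem k j))) * partialInnerPath π S ξ i j p = partialInnerPath π S ξ i j p := by
  cases p with
  | nil => simp [partialInnerPath]
  | cons p a =>
    rw [partialInnerPath, mul_add, ← left_mul_right, right_idem_mul_arrowCommutator π S hξ,
      right_mul_right, ← map_mul, ofPath_mul_idem]

theorem partialInnerPath_comp {i l j : V} (p : Quiver.Path i l) (q : Quiver.Path l j) :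
    partialInnerPath π S ξ i j (p.comp q) =
      (π (ofPath k p) ⊗ₜ[k] op 1) * partialInnerPath π S ξ l j q +
        (1 ⊗ₜ[k] op (π (ofPath k q))) * partialInnerPath π S ξ i l p := by
  induction q with
  | nil =>
    rw [partialInnerPath, mul_zero, zero_add]
    exact (right_idem_mul_partialInnerPath π S hξ p).symm
  | cons q a ih =>
    rw [Quiver.Path.comp_cons, partialInnerPath, partialInnerPath, ih, mul_add, mul_add,
      left_mul_left, map_path_mul, left_mul_right, right_mul_right, map_path_mul, add_assoc]
    rfl

theorem partialInner_mul (x y : PathAlgebra k V) :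
    partialInner π S ξ (x * y) =
      (π x ⊗ₜ[k] op 1) * partialInner π S ξ y + (1 ⊗ₜ[k] op (π y)) * partialInner π S ξ x := by
  induction x using ofPath_induction with
  | zero => simp
  | add x x' hx hx' =>
    rw [add_mul, map_add, hx, hx', map_add, map_add, add_tmul, add_mul, mul_add]; abel
  | smul c x hx =>
    rw [smul_mul_assoc, map_smul, hx, map_smul, map_smul, smul_add, ← smul_tmul', smul_mul_assoc,
      mul_smul_comm]
  | path i l p =>
    induction y using ofPath_induction with
    | zero => simp
    | add y y' hy hy' =>
      rw [mul_add, map_add, hy, hy', map_add, map_add, MulOpposite.op_add, tmul_add, add_mul,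
        mul_add]
      abel
    | smul c y hy =>
      rw [mul_smul_comm, map_smul, hy, map_smul, map_smul, smul_add, op_smul, tmul_smul,
        smul_mul_assoc, mul_smul_comm]
    | path l' j q =>
      simp only [partialInner, extendLinearly_ofPath]
      by_cases h : l = l'
      · subst h
        rw [ofPath_mul_ofPath, extendLinearly_ofPath, partialInnerPath_comp π S hξ]
      · rw [ofPath_mul_ofPath_ne h, map_zero,
          ← left_idem_mul_partialInnerPath π S q, left_mul_left, ← map_mul,
          ← right_idem_mul_partialInnerPath π S hξ p, right_mul_right, ← map_mul, idem, idem,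
          ofPath_mul_ofPath_ne h, ofPath_mul_ofPath_ne h]
        simp

theorem partialInnerPath_of_forall_mem {i j : V} (p : Quiver.Path i j)
    (hp : ∀ a ∈ p.arrowList, a ∈ S) :
    partialInnerPath π S ξ i j p = commutator k (π (ofPath k p)) * ξ := by
  induction p with
  | nil => rw [partialInnerPath]; exact (hξ i).symm
  | cons p a ih =>
    simp only [Quiver.Path.arrowList, List.mem_append, List.mem_singleton] at hp
    rw [partialInnerPath, ih fun b hb => hp b (Or.inl hb), arrowCommutator,
      if_pos (hp _ (Or.inr rfl)), ← mul_assoc, ← mul_assoc, ← add_mul, ← commutator_mul,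
      map_path_mul]
    rfl

omit hξ in
theorem partialInnerPath_of_forall_notMem {i j : V} (p : Quiver.Path i j)
    (hp : ∀ a ∈ p.arrowList, a ∉ S) : partialInnerPath π S ξ i j p = 0 := by
  induction p with
  | nil => rfl
  | cons p a ih =>
    simp only [Quiver.Path.arrowList, List.mem_append, List.mem_singleton] at hp
    rw [partialInnerPath, ih fun b hb => hp b (Or.inl hb), arrowCommutator,
      if_neg (hp _ (Or.inr rfl)), mul_zero, mul_zero, add_zero]

theorem partialInner_single_of_forall_mem {i j : V} (x : Quiver.Path i j →₀ k)
    (hx : ∀ p, x p ≠ 0 → ∀ a ∈ p.arrowList, a ∈ S) :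
    partialInner π S ξ (single k i j x) = commutator k (π (single k i j x)) * ξ := by
  have h : single k i j x = ∑ p ∈ x.support, x p • ofPath k p := by
    conv_lhs => rw [← Finsupp.sum_single x, Finsupp.sum, map_sum]
    refine Finset.sum_congr rfl fun p _ => ?_
    rw [ofPath_eq_single, ← map_smul, Finsupp.smul_single, smul_eq_mul, mul_one]
  rw [h, map_sum, map_sum, map_sum, Finset.sum_mul]
  refine Finset.sum_congr rfl fun p hp => ?_
  rw [map_smul, map_smul, map_smul, smul_mul_assoc, partialInner, extendLinearly_ofPath,
    partialInnerPath_of_forall_mem π S hξ p (hx p (Finsupp.mem_support_iff.1 hp))]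

omit hξ in
theorem partialInner_single_of_forall_notMem {i j : V} (x : Quiver.Path i j →₀ k)
    (hx : ∀ p, x p ≠ 0 → ∀ a ∈ p.arrowList, a ∉ S) :
    partialInner π S ξ (single k i j x) = 0 := by
  rw [partialInner, extendLinearly_single, Finsupp.linearCombination_apply, Finsupp.sum]
  refine Finset.sum_eq_zero fun p hp => ?_
  rw [partialInnerPath_of_forall_notMem π S p (hx p (Finsupp.mem_support_iff.1 hp)), smul_zero]

end Derivation

/-! ### Coefficients of products with an arrow -/

section Coefficients

variable {k V : Type*} [Field k] [Quiver V] [Fintype V] [DecidableEq V] {u v : V} (a : u ⟶ v)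
  (x : PathAlgebra k V)

theorem arrow_mul_apply_arrow : (ofPath k a.toPath * x) u v a.toPath = x v v .nil := by
  refine linearMap_ext (f := coeffPath k a.toPath ∘ₗ LinearMap.mulLeft k (ofPath k a.toPath))
    (g := coeffPath k .nil) (fun i j p => ?_) x
  change (ofPath k a.toPath * ofPath k p) u v a.toPath = ofPath k p v v .nil
  by_cases h : v = i
  · subst h
    rw [ofPath_mul_ofPath, ofPath_apply, ofPath_apply]
    refine if_congr ⟨fun h => ?_, fun h => by cases h; rfl⟩ rfl rfl
    rw [Sigma.mk.injEq] at h
    replace h := eq_of_heq h.2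
    rw [Sigma.mk.injEq] at h
    obtain ⟨rfl, h⟩ := h
    have := congrArg Quiver.Path.length (eq_of_heq h)
    simp at this
    rw [this]
  · rw [ofPath_mul_ofPath_ne h, ofPath_apply_ne (fun hh => h hh.1)]
    rfl

theorem mul_arrow_apply_arrow : (x * ofPath k a.toPath) u v a.toPath = x u u .nil := by
  have := mul_ofPath_apply_comp x a.toPath (Quiver.Path.nil : Quiver.Path u u) a.toPath rfl
  rwa [Quiver.Path.nil_comp, if_pos rfl] at this

theorem arrow_mul_apply_nil (i : V) : (ofPath k a.toPath * x) i i .nil = 0 := by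
  refine linearMap_ext (f := coeffPath k (.nil : Quiver.Path i i) ∘ₗ
    LinearMap.mulLeft k (ofPath k a.toPath)) (g := 0) (fun m j p => ?_) x
  change (ofPath k a.toPath * ofPath k p) i i .nil = 0
  by_cases h : v = m
  · subst h
    rw [ofPath_mul_ofPath, ofPath_apply, if_neg]
    intro h
    have := congrArg (fun z : Σ a b : V, Quiver.Path a b => z.2.2.length) h
    simp at this
  · rw [ofPath_mul_ofPath_ne h]
    rfl

theorem mul_arrow_apply_nil (i : V) : (x * ofPath k a.toPath) i i .nil = 0 := by
  refine linearMap_ext (f := coeffPath k (.nil : Quiver.Path i i) ∘ₗ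
    LinearMap.mulRight k (ofPath k a.toPath)) (g := 0) (fun m j p => ?_) x
  change (ofPath k p * ofPath k a.toPath) i i .nil = 0
  by_cases h : j = u
  · subst h
    rw [ofPath_mul_ofPath, ofPath_apply, if_neg]
    intro h
    have := congrArg (fun z : Σ a b : V, Quiver.Path a b => z.2.2.length) h
    simp at this
  · rw [ofPath_mul_ofPath_ne h]
    rfl

end Coefficients

/-! ### An outer derivation of the derivation-quotient algebra -/

section Quotient

variable {k V : Type*} [Field k] [Quiver V] [Fintype V] [DecidableEq V]

theorem mk_eq_zero_iff (I : TwoSidedIdeal (PathAlgebra k V)) (x : PathAlgebra k V) :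
    I.ringCon.mkₐ k x = 0 ↔ x ∈ I :=
  (RingCon.eq _).trans (I.mem_iff x).symm

/-- A linear map that vanishes on a two-sided ideal factors through the quotient. -/
theorem exists_factor (I : TwoSidedIdeal (PathAlgebra k V)) {W : Type*} [AddCommGroup W]
    [Module k W] (f : PathAlgebra k V →ₗ[k] W) (hf : ∀ x ∈ I, f x = 0) :
    ∃ g : I.ringCon.Quotient →ₗ[k] W, ∀ x, g (I.ringCon.mkₐ k x) = f x := by
  have hsurj : Function.Surjective (I.ringCon.mkₐ k).toLinearMap :=
    I.ringCon.mkₐ_surjective (α := k)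
  let e := (I.ringCon.mkₐ k).toLinearMap.quotKerEquivOfSurjective hsurj
  refine ⟨(Submodule.liftQ (LinearMap.ker (I.ringCon.mkₐ k).toLinearMap) f fun x hx =>
    hf x ((mk_eq_zero_iff I x).1 hx)) ∘ₗ e.symm.toLinearMap, fun x => ?_⟩
  have h : e.symm (I.ringCon.mkₐ k x) = Submodule.Quotient.mk x := by
    rw [LinearEquiv.symm_apply_eq]; rfl
  rw [LinearMap.comp_apply]
  refine (congrArg _ h).trans ?_
  exact Submodule.liftQ_apply _ _ _

variable {ω : PathAlgebra k V} {s : ℕ}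

/-- Suppose that the support of `ω` is partitioned along `S`, and that the vertex `i` is incident
with an arrow in `S` and with an arrow outside `S`. Then the derivation that agrees with
`[·, e_i ⊗ e_i]` on `S` and vanishes on the other arrows is not inner. -/
theorem not_subsingleton_ext_one (hs : 3 ≤ s) (hω : ω ∈ gradedPart k V s)
    (hdiag : ∀ i j : V, i ≠ j → ω i j = 0) (S : Set (Quiver.Total V))
    (hcycle : ∀ (i : V) (p : Quiver.Path i i), p.length = s →
      (∀ a ∈ p.arrowList, a ∈ S) ∨ (∀ a ∈ p.arrowList, a ∉ S))
    {i : V} {a b : Quiver.Total V} (ha : a ∈ S) (hai : a.left = i ∨ a.right = i)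
    (hb : b ∉ S) (hbi : b.left = i ∨ b.right = i) :
    ¬ Subsingleton (ExtEnv k (DerivationQuotient ω) 1) := by
  intro hsub
  let π := (derivIdeal ω).ringCon.mkₐ k
  let ξ : Env k (DerivationQuotient ω) := π (idem k i) ⊗ₜ[k] op (π (idem k i))
  have hξ : ∀ j, commutator k (π (idem k j)) * ξ = 0 := by
    intro j
    rw [commutator_apply, sub_mul, Algebra.TensorProduct.tmul_mul_tmul,
      Algebra.TensorProduct.tmul_mul_tmul, ← op_mul, ← op_mul, one_mul, mul_one, ← map_mul,
      ← map_mul]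
    by_cases h : j = i
    · subst h
      rw [show idem k j * idem k j = idem k j from idem_mul_ofPath _, sub_self]
    · rw [idem, idem, ofPath_mul_ofPath_ne h, ofPath_mul_ofPath_ne (Ne.symm h)]
      simp
  -- The derivation vanishes on each `∂_c ω`, all of whose paths lie on the side of `c`.
  have hrel : ∀ c : Quiver.Total V, partialInner π S ξ (deriv k c ω) = 0 := by
    rintro ⟨j, m, c⟩
    have hmem : deriv k ⟨j, m, c⟩ ω ∈ derivIdeal ω := TwoSidedIdeal.subset_span ⟨_, rfl⟩
    have hpath : ∀ p, relation ω c p ≠ 0 → (∀ a ∈ (c.toPath.comp p).arrowList, a ∈ S) ∨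
        (∀ a ∈ (c.toPath.comp p).arrowList, a ∉ S) := fun p hp =>
      hcycle j _ (mem_lengthIn.1 (apply_mem_lengthIn hω j j) _ hp)
    have hl : ∀ p : Quiver.Path m j, (c.toPath.comp p).arrowList =
        (⟨j, m, c⟩ : Quiver.Total V) :: p.arrowList := fun p => by
      rw [Quiver.Path.arrowList_comp, Quiver.Path.arrowList_toPath]; rfl
    rw [deriv_eq_single hdiag] at hmem ⊢
    by_cases hc : (⟨j, m, c⟩ : Quiver.Total V) ∈ S
    · rw [partialInner_single_of_forall_mem π S hξ, (mk_eq_zero_iff _ _).2 hmem, map_zero, zero_mul]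
      intro p hp
      rcases hpath p hp with h | h <;> rw [hl] at h
      · exact fun a ha => h a (List.mem_cons_of_mem _ ha)
      · exact absurd hc (h _ List.mem_cons_self)
    · refine partialInner_single_of_forall_notMem π S _ fun p hp => ?_
      rcases hpath p hp with h | h <;> rw [hl] at h
      · exact absurd (h _ List.mem_cons_self) hc
      · exact fun a ha => h a (List.mem_cons_of_mem _ ha)
  have hvanish : ∀ x ∈ derivIdeal ω, partialInner π S ξ x = 0 := by
    let T : TwoSidedIdeal (PathAlgebra k V) := TwoSidedIdeal.mk'
      {x | π x = 0 ∧ partialInner π S ξ x = 0}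
      ⟨map_zero _, map_zero _⟩
      (fun hx hy => ⟨by rw [map_add, hx.1, hy.1, add_zero], by rw [map_add, hx.2, hy.2, add_zero]⟩)
      (fun hx => ⟨by rw [map_neg, hx.1, neg_zero], by rw [map_neg, hx.2, neg_zero]⟩)
      (fun {x y} hy => ⟨by rw [map_mul, hy.1, mul_zero], by
        rw [partialInner_mul π S hξ, hy.1, hy.2]; simp⟩)
      (fun {x y} hx => ⟨by rw [map_mul, hx.1, zero_mul], by
        rw [partialInner_mul π S hξ, hx.1, hx.2]; simp⟩)
    have hT : ∀ y, y ∈ T ↔ π y = 0 ∧ partialInner π S ξ y = 0 := fun y =>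
      TwoSidedIdeal.mem_mk' _ _ _ _ _ _ _
    have hle : derivIdeal ω ≤ T := by
      rw [derivIdeal, TwoSidedIdeal.span_le]
      rintro _ ⟨c, rfl⟩
      exact (hT _).2 ⟨(mk_eq_zero_iff _ _).2 (TwoSidedIdeal.subset_span ⟨c, rfl⟩), hrel c⟩
    exact fun x hx => ((hT x).1 (hle hx)).2
  have hsurj : Function.Surjective π := (derivIdeal ω).ringCon.mkₐ_surjective (α := k)
  obtain ⟨δ, hδ⟩ := exists_factor _ _ hvanish
  replace hδ : ∀ x, δ (π x) = partialInner π S ξ x := hδ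
  obtain ⟨η, hη⟩ := exists_eq_commutator_mul hsub δ (fun x y => by
    obtain ⟨x, rfl⟩ := hsurj x
    obtain ⟨y, rfl⟩ := hsurj y
    rw [← map_mul, hδ, hδ, hδ, partialInner_mul π S hξ])
  -- Coefficients at paths of length at most one are well defined on the quotient.
  have hcoeff : ∀ (m n : V) (p : Quiver.Path m n), p.length < s - 1 →
      ∃ f : DerivationQuotient ω →ₗ[k] k, ∀ x, f (π x) = x m n p := fun m n p hp =>
    exists_factor _ (coeffPath k p) fun x hx =>
      apply_eq_zero_of_mem_lowDegreeBound hω hs (apply_mem_lowDegreeBound hω hs hdiag hx m n) p hp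
  have h1 : 1 < s - 1 := by omega
  obtain ⟨ε, hε⟩ := hcoeff i i .nil (by simp; omega)
  have hkey : ∀ (c : Quiver.Total V), (c.left = i ∨ c.right = i) → ∀ θ,
      commutator k (π (ofPath k c.hom.toPath)) * θ = 0 → tensorFunctional ε ε θ = 0 := by
    rintro ⟨u, v, c⟩ hc θ hθ
    obtain ⟨χ, hχ⟩ := hcoeff u v c.toPath (by simpa using h1)
    rcases hc with h | h
    · obtain rfl : u = i := h
      have h2 := tensorFunctional_commutator_mul ε χ (π (ofPath k c.toPath)) θ
      have h3 : ε ∘ₗ LinearMap.mulLeft k (π (ofPath k c.toPath)) = 0 := by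
        ext x
        obtain ⟨x, rfl⟩ := hsurj x
        simp only [LinearMap.comp_apply, LinearMap.mulLeft_apply]
        rw [← map_mul, hε, arrow_mul_apply_nil]; rfl
      have h4 : χ ∘ₗ LinearMap.mulRight k (π (ofPath k c.toPath)) = ε := by
        ext x
        obtain ⟨x, rfl⟩ := hsurj x
        simp only [LinearMap.comp_apply, LinearMap.mulRight_apply]
        rw [← map_mul, hχ, mul_arrow_apply_arrow, hε]
      rw [hθ, h3, h4, map_zero] at h2
      have h5 : tensorFunctional (0 : DerivationQuotient ω →ₗ[k] k) χ θ = 0 := by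
        simp [tensorFunctional]
      rw [h5, zero_sub] at h2
      exact neg_eq_zero.1 h2.symm
    · obtain rfl : v = i := h
      have h2 := tensorFunctional_commutator_mul χ ε (π (ofPath k c.toPath)) θ
      have h3 : ε ∘ₗ LinearMap.mulRight k (π (ofPath k c.toPath)) = 0 := by
        ext x
        obtain ⟨x, rfl⟩ := hsurj x
        simp only [LinearMap.comp_apply, LinearMap.mulRight_apply]
        rw [← map_mul, hε, mul_arrow_apply_nil]; rfl
      have h4 : χ ∘ₗ LinearMap.mulLeft k (π (ofPath k c.toPath)) = ε := by
        ext x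
        obtain ⟨x, rfl⟩ := hsurj x
        simp only [LinearMap.comp_apply, LinearMap.mulLeft_apply]
        rw [← map_mul, hχ, arrow_mul_apply_arrow, hε]
      rw [hθ, h3, h4, map_zero] at h2
      have h5 : tensorFunctional χ (0 : DerivationQuotient ω →ₗ[k] k) θ = 0 := by
        simp [tensorFunctional]
      rw [h5, sub_zero] at h2
      exact h2.symm
  have hlist : ∀ c : Quiver.Total V, c.hom.toPath.arrowList = [c] := fun c =>
    Quiver.Path.arrowList_toPath c.hom
  have hA : tensorFunctional ε ε (η - ξ) = 0 := by
    refine hkey a hai _ ?_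
    rw [mul_sub, ← hη, hδ, partialInner, extendLinearly_ofPath,
      partialInnerPath_of_forall_mem π S hξ _ (by rw [hlist]; simpa using ha), sub_self]
  have hB : tensorFunctional ε ε η = 0 := by
    refine hkey b hbi _ ?_
    rw [← hη, hδ, partialInner, extendLinearly_ofPath,
      partialInnerPath_of_forall_notMem π S _ (by rw [hlist]; simpa using hb)]
  have hC : tensorFunctional ε ε ξ = 1 := by
    have : ε (π (idem k i)) = 1 := by
      rw [hε, idem, ofPath_apply_self, Finsupp.single_eq_same]
    rw [tensorFunctional_tmul, this, mul_one]
  rw [map_sub, hB, hC, zero_sub] at hA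
  exact one_ne_zero (neg_eq_zero.1 hA)

end Quotient

end PathAlgebra

/-! ### Counting paths -/

namespace Quiver.Path

variable {V : Type*} [Quiver V]

/-- A path of length `n + 1` is a path of length `n` followed by an arrow. -/
def lengthSuccEquiv (n : ℕ) (i j : V) :
    {p : Path i j // p.length = n + 1} ≃ Σ l, {p : Path i l // p.length = n} × (l ⟶ j) where
  toFun
    | ⟨.cons p a, h⟩ => ⟨_, ⟨p, by simpa using h⟩, a⟩
  invFun x := ⟨x.2.1.1.cons x.2.2, by simp [x.2.1.2]⟩
  left_inv
    | ⟨.cons p a, h⟩ => rfl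
  right_inv _ := rfl

variable [Fintype V] [∀ i j : V, Fintype (i ⟶ j)]

theorem finite_length_eq (n : ℕ) (i j : V) : Finite {p : Path i j // p.length = n} := by
  induction n generalizing j with
  | zero =>
    refine Finite.of_injective (β := Unit) (fun _ => ()) ?_
    rintro ⟨p, hp⟩ ⟨q, hq⟩ -
    obtain rfl := eq_of_length_zero p hp
    obtain rfl := eq_nil_of_length_zero p hp
    obtain rfl := eq_nil_of_length_zero q hq
    rfl
  | succ n ih =>
    have := fun l => ih l
    exact Finite.of_equiv _ (lengthSuccEquiv n i j).symm

theorem card_length_eq [DecidableEq V] (n : ℕ) (i j : V) :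
    (Nat.card {p : Path i j // p.length = n} : ℤ) = (incidenceMatrix V ^ n) i j := by
  induction n generalizing j with
  | zero =>
    rw [pow_zero, Matrix.one_apply]
    split_ifs with h
    · subst h
      have : Unique {p : Path i i // p.length = 0} :=
        { default := ⟨nil, rfl⟩
          uniq := fun p => Subtype.ext (eq_nil_of_length_zero _ p.2) }
      rw [Nat.card_unique, Nat.cast_one]
    · have : IsEmpty {p : Path i j // p.length = 0} :=
        ⟨fun p => h (eq_of_length_zero _ p.2)⟩
      rw [Nat.card_of_isEmpty, Nat.cast_zero]
  | succ n ih =>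
    have := fun l => finite_length_eq n i l
    rw [Nat.card_congr (lengthSuccEquiv n i j), Nat.card_sigma, pow_succ, Matrix.mul_apply,
      Nat.cast_sum]
    refine Finset.sum_congr rfl fun l _ => ?_
    rw [Nat.card_prod, Nat.cast_mul, ih, Nat.card_eq_fintype_card]
    rfl

end Quiver.Path

/-! ### Coefficients of the two Hilbert series -/

namespace PathAlgebra

variable {k V : Type*} [Field k] [Quiver V] [Fintype V] [DecidableEq V]
  [∀ i j : V, Fintype (i ⟶ j)]

instance (n : ℕ) (i j : V) : FiniteDimensional k (lengthIn k {n} i j) := by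
  have : Finite {p : Quiver.Path i j | p.length ∈ ({n} : Set ℕ)} :=
    Quiver.Path.finite_length_eq n i j
  exact Module.Finite.equiv (Finsupp.supportedEquivFinsupp _).symm

variable (k) in
theorem finrank_lengthIn (n : ℕ) (i j : V) :
    (Module.finrank k (lengthIn k {n} i j) : ℤ) = (incidenceMatrix V ^ n) i j := by
  have : Finite {p : Quiver.Path i j | p.length ∈ ({n} : Set ℕ)} :=
    Quiver.Path.finite_length_eq n i j
  have := Fintype.ofFinite {p : Quiver.Path i j | p.length ∈ ({n} : Set ℕ)}
  rw [← Quiver.Path.card_length_eq, lengthIn,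
    (Finsupp.supportedEquivFinsupp (M := k) (R := k)
      {p : Quiver.Path i j | p.length ∈ ({n} : Set ℕ)}).finrank_eq,
    Module.finrank_finsupp_self, ← Nat.card_eq_fintype_card]
  rfl

theorem finrank_map_add_finrank_ker_inf {W B : Type*} [AddCommGroup W] [Module k W] [Ring B]
    [Algebra k B] (f : W →ₗ[k] B) (N : Submodule k W) [FiniteDimensional k N] :
    Module.finrank k (N.map f) + Module.finrank k (LinearMap.ker f ⊓ N : Submodule k W) =
      Module.finrank k N := by
  have h := LinearMap.finrank_range_add_finrank_ker (f.domRestrict N)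
  rw [LinearMap.range_domRestrict, LinearMap.ker_domRestrict] at h
  rw [← h, (Submodule.equivSubtypeMap N (Submodule.comap N.subtype (LinearMap.ker f))).finrank_eq,
    Submodule.map_comap_subtype, inf_comm]

/-- The elements of degree `n` of `e_i I e_j`, for a two-sided ideal `I` of `kQ`. -/
def idealPart (I : TwoSidedIdeal (PathAlgebra k V)) (n : ℕ) (i j : V) :
    Submodule k (Quiver.Path i j →₀ k) :=
  LinearMap.ker ((I.ringCon.mkₐ k).toLinearMap ∘ₗ single k i j) ⊓ lengthIn k {n} i j

theorem mem_idealPart {I : TwoSidedIdeal (PathAlgebra k V)} {n : ℕ} {i j : V}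
    {x : Quiver.Path i j →₀ k} :
    x ∈ idealPart I n i j ↔ single k i j x ∈ I ∧ x ∈ lengthIn k {n} i j := by
  rw [idealPart, Submodule.mem_inf, LinearMap.mem_ker]
  exact and_congr_left fun _ => mk_eq_zero_iff I _

/-- The coefficients of the Hilbert series of a quotient of the path algebra. -/
theorem coeff_hilbertSeries (I : TwoSidedIdeal (PathAlgebra k V)) (n : ℕ) (i j : V) :
    PowerSeries.coeff n (hilbertSeries I) i j =
      (incidenceMatrix V ^ n) i j - Module.finrank k (idealPart I n i j) := by
  let f := (I.ringCon.mkₐ k).toLinearMap ∘ₗ single k i j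
  have h1 : ((gradedPart k V n).map (I.ringCon.mkₐ k).toLinearMap).map
      (LinearMap.mulLeftRight k (I.ringCon.mk' (idem k i), I.ringCon.mk' (idem k j))) =
        (lengthIn k {n} i j).map f := by
    have h : ∀ x : PathAlgebra k V,
        LinearMap.mulLeftRight k (I.ringCon.mk' (idem k i), I.ringCon.mk' (idem k j))
          ((I.ringCon.mkₐ k).toLinearMap x) = f (x i j) := by
      intro x
      change I.ringCon.mkₐ k (idem k i) * I.ringCon.mkₐ k x * I.ringCon.mkₐ k (idem k j) =
        I.ringCon.mkₐ k (single k i j (x i j))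
      rw [← map_mul, ← map_mul, idem_mul_mul_idem]
    apply le_antisymm
    · rintro _ ⟨_, ⟨x, hx, rfl⟩, rfl⟩
      exact ⟨x i j, apply_mem_lengthIn hx i j, (h x).symm⟩
    · rintro _ ⟨x, hx, rfl⟩
      refine ⟨_, ⟨single k i j x, single_mem_gradedPart hx, rfl⟩, ?_⟩
      rw [h, single_same]
  have h2 : Module.finrank k ((lengthIn k {n} i j).map f) + Module.finrank k (idealPart I n i j) =
      Module.finrank k (lengthIn k {n} i j) := finrank_map_add_finrank_ker_inf f _
  rw [hilbertSeries, PowerSeries.coeff_mk, Matrix.of_apply, h1, ← finrank_lengthIn k, ← h2]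
  push_cast
  ring

end PathAlgebra

section Series

open PowerSeries

variable {V : Type*} [Fintype V] [DecidableEq V] (M : Matrix V V ℤ) {s : ℕ}

theorem coeff_typeSeries (hs : 3 ≤ s) (n : ℕ) :
    coeff n (typeSeries M s) = (if n = 0 then 1 else 0) + M * coeff n (X * typeSeries M s)
      - (if s - 1 ≤ n then M.transpose * coeff (n - (s - 1)) (typeSeries M s) else 0)
      + if s ≤ n then coeff (n - s) (typeSeries M s) else 0 := by
  have h := typePolynomial_mul_typeSeries M (s := s) (by omega)
  rw [typePolynomial, sub_mul, add_mul, sub_mul, one_mul, mul_assoc, mul_assoc] at h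
  have h2 : typeSeries M s = 1 + C M * (X * typeSeries M s)
      - C M.transpose * (X ^ (s - 1) * typeSeries M s) + X ^ s * typeSeries M s := by
    rw [← h]; abel
  conv_lhs => rw [h2]
  rw [map_add, map_sub, map_add, coeff_C_mul, coeff_C_mul, coeff_X_pow_mul', coeff_X_pow_mul',
    coeff_one, mul_ite, mul_zero]

theorem coeff_typeSeries_of_lt (hs : 3 ≤ s) {n : ℕ} (hn : n < s - 1) :
    coeff n (typeSeries M s) = M ^ n := by
  induction n with
  | zero => rw [coeff_typeSeries M hs, if_pos rfl, if_neg (by omega), if_neg (by omega)]; simp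
  | succ n ih =>
    rw [coeff_typeSeries M hs, if_neg (by omega), if_neg (by omega), if_neg (by omega),
      coeff_succ_X_mul, ih (by omega), pow_succ']
    simp

theorem coeff_typeSeries_pred (hs : 3 ≤ s) :
    coeff (s - 1) (typeSeries M s) = M ^ (s - 1) - M.transpose := by
  rw [coeff_typeSeries M hs, if_neg (by omega), if_pos le_rfl, if_neg (by omega), Nat.sub_self,
    coeff_typeSeries_of_lt M hs (by omega : 0 < s - 1), show s - 1 = (s - 2) + 1 by omega,
    coeff_succ_X_mul, coeff_typeSeries_of_lt M hs (by omega : s - 2 < s - 1), pow_succ']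
  simp

theorem coeff_typeSeries_self (hs : 3 ≤ s) :
    coeff s (typeSeries M s) = M ^ s - (M * M.transpose + M.transpose * M) + 1 := by
  rw [coeff_typeSeries M hs, if_neg (by omega), if_pos (by omega), if_pos le_rfl, Nat.sub_self,
    coeff_typeSeries_of_lt M hs (by omega : 0 < s - 1), show s - (s - 1) = 1 by omega,
    coeff_typeSeries_of_lt M hs (by omega : 1 < s - 1)]
  obtain ⟨t, rfl⟩ : ∃ t, s = t + 1 := ⟨s - 1, by omega⟩
  have := coeff_typeSeries_pred M hs
  rw [Nat.add_sub_cancel] at this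
  rw [coeff_succ_X_mul, this, mul_sub, pow_one, pow_zero, ← pow_succ']
  abel

end Series

namespace PathAlgebra

open Classical

variable {k V : Type*} [Field k] [Quiver V] [Fintype V] [DecidableEq V]
  [∀ i j : V, Fintype (i ⟶ j)]

/-! ### The two expansions of a superpotential -/

/-- The part of `x` that consists of the paths whose first arrow lies in `S`. -/
theorem sum_toPath_concat_leftQuot_apply (S : Set (Quiver.Total V)) {i j l : V}
    (x : Quiver.Path i j →₀ k) (a : i ⟶ l) (q : Quiver.Path l j) :
    (∑ o : Σ l, (i ⟶ l), if (⟨i, o.1, o.2⟩ : Quiver.Total V) ∈ S then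
      concat k i o.1 j (Finsupp.single o.2.toPath 1) (leftQuot o.2 x) else 0) (a.toPath.comp q) =
        if (⟨i, l, a⟩ : Quiver.Total V) ∈ S then x (a.toPath.comp q) else 0 := by
  rw [Finsupp.finsetSum_apply, Finset.sum_eq_single ⟨l, a⟩]
  · split_ifs
    · rw [concat_single_apply_comp, leftQuot_apply]
    · rfl
  · rintro ⟨l', a'⟩ _ hne
    split_ifs
    · refine concat_single_apply_of_forall_ne _ _ _ fun q' h => hne ?_
      cases Quiver.Path.sigma_eq_of_toPath_comp_eq h
      rfl
    · rfl
  · simp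

/-- The part of `x` that consists of the paths whose last arrow lies in `S`. -/
theorem sum_rightQuot_concat_toPath_apply (S : Set (Quiver.Total V)) {i j l : V}
    (x : Quiver.Path i j →₀ k) (q : Quiver.Path i l) (a : l ⟶ j) :
    (∑ o : Σ l, (l ⟶ j), if (⟨o.1, j, o.2⟩ : Quiver.Total V) ∈ S then
      concat k i o.1 j (rightQuot o.2 x) (Finsupp.single o.2.toPath 1) else 0) (q.cons a) =
        if (⟨l, j, a⟩ : Quiver.Total V) ∈ S then x (q.cons a) else 0 := by
  rw [Finsupp.finsetSum_apply, Finset.sum_eq_single ⟨l, a⟩]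
  · split_ifs
    · have := concat_right_single_apply_comp (rightQuot a x) a.toPath q
      rwa [rightQuot_apply, Quiver.Path.comp_toPath_eq_cons] at this
    · rfl
  · rintro ⟨l', a'⟩ _ hne
    split_ifs
    · refine concat_right_single_apply_of_forall_ne _ _ _ fun q' h => hne ?_
      rw [Quiver.Path.comp_toPath_eq_cons, Quiver.Path.cons.injEq] at h
      obtain ⟨rfl, -, h⟩ := h
      rw [eq_of_heq h]
    · rfl
  · simp

/-- If every path in the support of `x` lies in `S` or in its complement, the expansions of the
`S`-part of `x` along first arrows and along last arrows agree. -/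
theorem sum_leftQuot_eq_sum_rightQuot (S : Set (Quiver.Total V)) {i j : V}
    (x : Quiver.Path i j →₀ k) (hx : ∀ p, x p ≠ 0 →
      (∀ a ∈ p.arrowList, a ∈ S) ∨ (∀ a ∈ p.arrowList, a ∉ S)) :
    (∑ o : Σ l, (i ⟶ l), if (⟨i, o.1, o.2⟩ : Quiver.Total V) ∈ S then
      concat k i o.1 j (Finsupp.single o.2.toPath 1) (leftQuot o.2 x) else 0) =
    ∑ o : Σ l, (l ⟶ j), if (⟨o.1, j, o.2⟩ : Quiver.Total V) ∈ S then
      concat k i o.1 j (rightQuot o.2 x) (Finsupp.single o.2.toPath 1) else 0 := by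
  ext p
  cases hp : p with
  | nil =>
    rw [Finsupp.finsetSum_apply, Finsupp.finsetSum_apply, Finset.sum_eq_zero, Finset.sum_eq_zero]
    · rintro o -
      split_ifs
      · refine concat_right_single_apply_of_forall_ne _ _ _ fun q h => ?_
        simpa using congrArg Quiver.Path.length h
      · rfl
    · rintro o -
      split_ifs
      · refine concat_single_apply_of_forall_ne _ _ _ fun q h => ?_
        have := congrArg Quiver.Path.length h
        rw [Quiver.Path.length_comp, Quiver.Path.length_toPath, Quiver.Path.length_nil] at this
        omega
      · rfl
  | @cons m _ q b =>
    rw [← hp]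
    obtain ⟨l, a, q', -, h⟩ := p.eq_toPath_comp_of_length_eq_succ (n := q.length) (by rw [hp]; rfl)
    conv_rhs => rw [hp, sum_rightQuot_concat_toPath_apply, ← hp]
    conv_lhs => rw [h, sum_toPath_concat_leftQuot_apply, ← h]
    by_cases h0 : x p = 0
    · rw [h0, ite_self, ite_self]
    · have ha : (⟨i, l, a⟩ : Quiver.Total V) ∈ p.arrowList := by
        rw [h, Quiver.Path.arrowList_comp, Quiver.Path.arrowList_toPath]
        exact List.mem_append_left _ List.mem_cons_self
      have hb : (⟨m, j, b⟩ : Quiver.Total V) ∈ p.arrowList := by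
        rw [hp, Quiver.Path.arrowList]
        exact List.mem_append_right _ List.mem_cons_self
      rcases hx p h0 with hS | hS
      · rw [if_pos (hS _ ha), if_pos (hS _ hb)]
      · rw [if_neg (hS _ ha), if_neg (hS _ hb)]

/-! ### Consequences of the expected Hilbert series -/

variable {ω : PathAlgebra k V} {s : ℕ}

theorem idealPart_le_lowDegreeBound (hs : 3 ≤ s) (hω : ω ∈ gradedPart k V s)
    (hdiag : ∀ i j : V, i ≠ j → ω i j = 0) {n : ℕ} {i j : V} {x : Quiver.Path i j →₀ k}
    (hx : x ∈ idealPart (derivIdeal ω) n i j) : x ∈ lowDegreeBound ω s i j := by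
  have := apply_mem_lowDegreeBound hω hs hdiag (mem_idealPart.1 hx).1 i j
  rwa [single_same] at this

/-- The expected dimension in degree `s - 1` forces the `∂_a ω` to be linearly independent. -/
theorem linearIndependent_relation (hs : 3 ≤ s) (hω : ω ∈ gradedPart k V s)
    (hdiag : ∀ i j : V, i ≠ j → ω i j = 0)
    (hcoeff : PowerSeries.coeff (s - 1) (hilbertSeries (derivIdeal ω)) =
      PowerSeries.coeff (s - 1) (typeSeries (incidenceMatrix V) s)) (i j : V) :
    LinearIndependent k fun a : j ⟶ i => relation ω a := by
  rw [linearIndependent_iff_card_le_finrank_span, Set.finrank]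
  have h := congrFun (congrFun hcoeff i) j
  rw [coeff_hilbertSeries, coeff_typeSeries_pred _ hs, Matrix.sub_apply, Matrix.transpose_apply,
    incidenceMatrix, Matrix.of_apply, sub_right_inj] at h
  rw [← (Nat.cast_injective h : _ = Fintype.card (j ⟶ i))]
  have := FiniteDimensional.span_of_finite k (Set.finite_range fun a : j ⟶ i => relation ω a)
  refine Submodule.finrank_mono fun x hx => ?_
  exact mem_span_relation hω hs (idealPart_le_lowDegreeBound hs hω hdiag hx)
    (mem_idealPart.1 hx).2

/-- Invariance under the twisted rotation expresses the `∂_a ω` through the right quotients of `ω`,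
by the linear part of `σ`. -/
theorem relation_eq_sum_rightQuot {σ : PathAlgebra k V ≃ₐ[k] PathAlgebra k V}
    (hσ : ∀ i : V, σ (idem k i) = idem k i) (hω : IsTwistedSuperpotential σ s ω)
    {i j : V} (a : j ⟶ i) :
    relation ω a =
      ∑ b : j ⟶ i, σ (ofPath k b.toPath) j i a.toPath • rightQuot b (ω i i) := by
  ext q
  rw [Finsupp.finsetSum_apply]
  simp only [Finsupp.smul_apply, smul_eq_mul, rightQuot_apply]
  rw [relation, leftQuot_apply]
  by_cases hq : q.length + 1 = s
  · conv_lhs => rw [← hω.2]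
    exact rotate_apply_toPath_comp hσ hω.1 a q hq
  · have h : ∀ (m : V) (p : Quiver.Path m m), p.length = q.length + 1 → ω m m p = 0 := by
      intro m p hp
      by_contra h
      exact hq (hp ▸ mem_lengthIn.1 (apply_mem_lengthIn hω.1 m m) p h)
    rw [h _ _ (by simp; omega)]
    exact (Finset.sum_eq_zero fun b _ => by rw [h _ _ (by simp), mul_zero]).symm

/-- If the `∂_a ω` are linearly independent, they span the same space as the right quotients
of `ω`. -/
theorem span_relation_eq_span_rightQuot {σ : PathAlgebra k V ≃ₐ[k] PathAlgebra k V}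
    (hσ : ∀ i : V, σ (idem k i) = idem k i) (hω : IsTwistedSuperpotential σ s ω)
    {i j : V} (hli : LinearIndependent k fun a : j ⟶ i => relation ω a) :
    Submodule.span k (Set.range fun a : j ⟶ i => relation ω a) =
      Submodule.span k (Set.range fun b : j ⟶ i => rightQuot b (ω i i)) := by
  have := FiniteDimensional.span_of_finite k
    (Set.finite_range fun b : j ⟶ i => rightQuot b (ω i i))
  refine Submodule.eq_of_le_of_finrank_le ?_ ?_
  · rw [Submodule.span_le]
    rintro _ ⟨a, rfl⟩
    simp only [SetLike.mem_coe, relation_eq_sum_rightQuot hσ hω]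
    exact Submodule.sum_mem _ fun b _ =>
      Submodule.smul_mem _ _ (Submodule.subset_span ⟨b, rfl⟩)
  · rw [finrank_span_eq_card hli]
    exact finrank_range_le_card _

theorem linearIndependent_rightQuot {σ : PathAlgebra k V ≃ₐ[k] PathAlgebra k V}
    (hσ : ∀ i : V, σ (idem k i) = idem k i) (hω : IsTwistedSuperpotential σ s ω)
    {i j : V} (hli : LinearIndependent k fun a : j ⟶ i => relation ω a) :
    LinearIndependent k fun b : j ⟶ i => rightQuot b (ω i i) := by
  rw [linearIndependent_iff_card_le_finrank_span, Set.finrank,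
    ← span_relation_eq_span_rightQuot hσ hω hli, finrank_span_eq_card hli]

/-- The expected dimension in degree `s` allows at most one linear relation, up to scalars, between
the products `a ∂_b ω` and `∂_b ω a` at a vertex. -/
theorem finrank_ker_relationMul_le (hs : 3 ≤ s) (hω : ω ∈ gradedPart k V s)
    (hdiag : ∀ i j : V, i ≠ j → ω i j = 0)
    (hcoeff : PowerSeries.coeff s (hilbertSeries (derivIdeal ω)) =
      PowerSeries.coeff s (typeSeries (incidenceMatrix V) s)) (i : V) :
    Module.finrank k (LinearMap.ker (Fintype.linearCombination k (relationMul ω i i))) ≤ 1 := by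
  have h := congrFun (congrFun hcoeff i) i
  rw [coeff_hilbertSeries, coeff_typeSeries_self _ hs, Matrix.add_apply, Matrix.sub_apply,
    Matrix.one_apply_eq] at h
  have hcard : (Fintype.card ((Σ l, (i ⟶ l) × (i ⟶ l)) ⊕ (Σ l, (l ⟶ i) × (l ⟶ i))) : ℤ) =
      (incidenceMatrix V * (incidenceMatrix V).transpose +
        (incidenceMatrix V).transpose * incidenceMatrix V) i i := by
    simp only [Fintype.card_sum, Fintype.card_sigma, Fintype.card_prod, Matrix.add_apply,
      Matrix.mul_apply, Matrix.transpose_apply, incidenceMatrix, Matrix.of_apply]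
    push_cast
    rfl
  have hrank := LinearMap.finrank_range_add_finrank_ker
    (Fintype.linearCombination k (relationMul ω i i))
  rw [Module.finrank_fintype_fun_eq_card, Fintype.range_linearCombination] at hrank
  have := FiniteDimensional.span_of_finite k (Set.finite_range (relationMul ω i i))
  have hle : Module.finrank k (idealPart (derivIdeal ω) s i i) ≤
      Module.finrank k (Submodule.span k (Set.range (relationMul ω i i))) :=
    Submodule.finrank_mono fun x hx =>
      mem_span_relationMul hω hs (idealPart_le_lowDegreeBound hs hω hdiag hx) (mem_idealPart.1 hx).2
  zify at hrank hle ⊢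
  rw [hcard] at hrank
  linarith

/-- The relation between the products `a ∂_b ω` and `∂_b ω a` that comes from the two expansions of
the `S`-part of `ω` at a vertex. -/
theorem exists_mem_ker_relationMul (S : Set (Quiver.Total V)) {i : V}
    (hx : ∀ p, ω i i p ≠ 0 → (∀ a ∈ p.arrowList, a ∈ S) ∨ (∀ a ∈ p.arrowList, a ∉ S))
    (hspan : ∀ (l : V) (b : l ⟶ i), rightQuot b (ω i i) ∈
      Submodule.span k (Set.range fun a : l ⟶ i => relation ω a)) :
    ∃ r ∈ LinearMap.ker (Fintype.linearCombination k (relationMul ω i i)),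
      ∀ (l : V) (a : i ⟶ l),
        r (.inl ⟨l, a, a⟩) = if (⟨i, l, a⟩ : Quiver.Total V) ∈ S then 1 else 0 := by
  have hc : ∀ (l : V) (b : l ⟶ i), ∃ c : (l ⟶ i) → k,
      ∑ a, c a • relation ω a = rightQuot b (ω i i) := fun l b =>
    (Submodule.mem_span_range_iff_exists_fun k).1 (hspan l b)
  choose c hc using hc
  refine ⟨Sum.elim
    (fun x => if x.2.1 = x.2.2 then
      if (⟨i, x.1, x.2.1⟩ : Quiver.Total V) ∈ S then 1 else 0 else 0)
    (fun x => - if (⟨x.1, i, x.2.2⟩ : Quiver.Total V) ∈ S then c x.1 x.2.2 x.2.1 else 0), ?_,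
    fun l a => by simp⟩
  rw [LinearMap.mem_ker, Fintype.linearCombination_apply, Fintype.sum_sum_type]
  have key := sum_leftQuot_eq_sum_rightQuot S (ω i i) hx
  rw [← sub_eq_zero, sub_eq_add_neg, ← Finset.sum_neg_distrib] at key
  rw [← key]
  simp only [Sum.elim_inl, Sum.elim_inr]
  congr 1
  · rw [Fintype.sum_sigma, Fintype.sum_sigma]
    refine Finset.sum_congr rfl fun l _ => ?_
    rw [Fintype.sum_prod_type]
    refine Finset.sum_congr rfl fun a _ => ?_
    rw [Finset.sum_eq_single a]
    · simp only [if_true, ite_smul, one_smul, zero_smul]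
      rfl
    · intro b _ hb
      simp only [if_neg (Ne.symm hb), zero_smul]
    · simp
  · rw [Fintype.sum_sigma, Fintype.sum_sigma]
    refine Finset.sum_congr rfl fun l _ => ?_
    rw [Fintype.sum_prod_type_right]
    refine Finset.sum_congr rfl fun a _ => ?_
    simp only
    split_ifs
    · rw [← hc, map_sum, LinearMap.sum_apply, ← Finset.sum_neg_distrib]
      refine Finset.sum_congr rfl fun b _ => ?_
      rw [map_smul, LinearMap.smul_apply, neg_smul]
      rfl
    · simp

/-- If the Hilbert series is the expected one up to degree `s`, no vertex has both an outgoing arrow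
in `S` and an outgoing arrow outside `S`: the two corresponding parts of `ω` would give two
independent relations. -/
theorem false_of_outgoing {σ : PathAlgebra k V ≃ₐ[k] PathAlgebra k V}
    (hσ : ∀ i : V, σ (idem k i) = idem k i) (hs : 3 ≤ s) (hω : IsTwistedSuperpotential σ s ω)
    (hdiag : ∀ i j : V, i ≠ j → ω i j = 0)
    (hli : ∀ i j : V, LinearIndependent k fun a : j ⟶ i => relation ω a)
    (hcoeff : PowerSeries.coeff s (hilbertSeries (derivIdeal ω)) =
      PowerSeries.coeff s (typeSeries (incidenceMatrix V) s)) (S : Set (Quiver.Total V))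
    (hcycle : ∀ (i : V) (p : Quiver.Path i i), p.length = s →
      (∀ a ∈ p.arrowList, a ∈ S) ∨ (∀ a ∈ p.arrowList, a ∉ S))
    {i l m : V} (a : i ⟶ l) (b : i ⟶ m) (ha : (⟨i, l, a⟩ : Quiver.Total V) ∈ S)
    (hb : (⟨i, m, b⟩ : Quiver.Total V) ∉ S) : False := by
  have hspan : ∀ (l : V) (b : l ⟶ i), rightQuot b (ω i i) ∈
      Submodule.span k (Set.range fun a : l ⟶ i => relation ω a) := fun l b => by
    rw [span_relation_eq_span_rightQuot hσ hω (hli i l)]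
    exact Submodule.subset_span ⟨b, rfl⟩
  have hsupp : ∀ p, ω i i p ≠ 0 →
      (∀ a ∈ p.arrowList, a ∈ S) ∨ (∀ a ∈ p.arrowList, a ∉ S) := fun p hp =>
    hcycle i p (mem_lengthIn.1 (apply_mem_lengthIn hω.1 i i) p hp)
  obtain ⟨r, hr, hrS⟩ := exists_mem_ker_relationMul S hsupp hspan
  obtain ⟨t, ht, htS⟩ := exists_mem_ker_relationMul Sᶜ
    (fun p hp => (hsupp p hp).symm.imp id fun h a ha hn => hn (h a ha)) hspan
  obtain ⟨v, hv⟩ := finrank_le_one_iff.1 (finrank_ker_relationMul_le hs hω.1 hdiag hcoeff i)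
  obtain ⟨c, hc⟩ := hv ⟨r, hr⟩
  obtain ⟨d, hd⟩ := hv ⟨t, ht⟩
  replace hc : ∀ x, c * v.1 x = r x := fun x => congrFun (congrArg Subtype.val hc) x
  replace hd : ∀ x, d * v.1 x = t x := fun x => congrFun (congrArg Subtype.val hd) x
  have h1 := hc (.inl ⟨l, a, a⟩)
  have h2 := hc (.inl ⟨m, b, b⟩)
  have h3 := hd (.inl ⟨m, b, b⟩)
  rw [hrS, if_pos ha] at h1
  rw [hrS, if_neg hb] at h2
  rw [htS, if_pos (show _ ∈ Sᶜ from hb)] at h3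
  rcases mul_eq_zero.1 h2 with h | h
  · rw [h, zero_mul] at h1; exact zero_ne_one h1
  · rw [h, mul_zero] at h3; exact zero_ne_one h3

/-- Every arrow occurs as the last arrow of a path in the support of `ω`, so an arrow that is
incident with `i` can be exchanged for an outgoing arrow on the same side of the partition. -/
theorem exists_outgoing {σ : PathAlgebra k V ≃ₐ[k] PathAlgebra k V}
    (hσ : ∀ i : V, σ (idem k i) = idem k i) (hω : IsTwistedSuperpotential σ s ω)
    (hli : ∀ i j : V, LinearIndependent k fun a : j ⟶ i => relation ω a)
    (S : Set (Quiver.Total V))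
    (hcycle : ∀ (i : V) (p : Quiver.Path i i), p.length = s →
      (∀ a ∈ p.arrowList, a ∈ S) ∨ (∀ a ∈ p.arrowList, a ∉ S))
    {i : V} (c : Quiver.Total V) (hc : c.left = i ∨ c.right = i) :
    ∃ (l : V) (a : i ⟶ l), (⟨i, l, a⟩ : Quiver.Total V) ∈ S ↔ c ∈ S := by
  obtain ⟨u, v, c⟩ := c
  rcases hc with h | h
  · obtain rfl : u = i := h
    exact ⟨v, c, Iff.rfl⟩
  · obtain rfl : v = i := h
    obtain ⟨q, hq⟩ := Finsupp.ne_iff.1 ((linearIndependent_rightQuot hσ hω (hli v u)).ne_zero c)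
    have hlen := mem_lengthIn.1 (apply_mem_lengthIn hω.1 v v) (q.cons c) hq
    obtain ⟨l, a, q', -, h⟩ :=
      (q.cons c).eq_toPath_comp_of_length_eq_succ (n := q.length) rfl
    have ha : (⟨v, l, a⟩ : Quiver.Total V) ∈ (q.cons c).arrowList := by
      rw [h, Quiver.Path.arrowList_comp, Quiver.Path.arrowList_toPath]
      exact List.mem_append_left _ List.mem_cons_self
    have hc : (⟨u, v, c⟩ : Quiver.Total V) ∈ (q.cons c).arrowList := by
      rw [Quiver.Path.arrowList]
      exact List.mem_append_right _ List.mem_cons_self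
    refine ⟨l, a, ?_⟩
    rcases hcycle v _ hlen with hS | hS
    · exact iff_of_true (hS _ ha) (hS _ hc)
    · exact iff_of_false (hS _ ha) (hS _ hc)

end PathAlgebra

/-- In a connected quiver whose arrows are divided into two nonempty classes, some vertex is
incident with arrows of both classes. -/
theorem Quiver.exists_incident_mem_and_notMem {V : Type*} [Quiver V]
    (hconn : Quiver.IsStronglyConnected (Quiver.Symmetrify V)) (S : Set (Quiver.Total V))
    {a b : Quiver.Total V} (ha : a ∈ S) (hb : b ∉ S) :
    ∃ (i : V) (a b : Quiver.Total V), a ∈ S ∧ (a.left = i ∨ a.right = i) ∧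
      b ∉ S ∧ (b.left = i ∨ b.right = i) := by
  by_contra! h
  have key : ∀ (j : Quiver.Symmetrify V)
      (_ : Quiver.Path (V := Quiver.Symmetrify V) a.left j),
      ∃ c : Quiver.Total V, c ∈ S ∧ (c.left = j ∨ c.right = j) := by
    intro j p
    induction p with
    | nil => exact ⟨a, ha, Or.inl rfl⟩
    | @cons l m _ e ih =>
      obtain ⟨c, hc, hcl⟩ := ih
      rcases e with e | e
      · refine ⟨⟨l, m, e⟩, ?_, Or.inr rfl⟩
        by_contra he
        exact (h l c ⟨l, m, e⟩ hc hcl he).1 rfl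
      · refine ⟨⟨m, l, e⟩, ?_, Or.inl rfl⟩
        by_contra he
        exact (h l c ⟨m, l, e⟩ hc hcl he).2 rfl
  obtain ⟨p⟩ := hconn a.left b.left
  obtain ⟨c, hc, hcl⟩ := key _ p
  exact (h b.left c b hc hcl hb).1 rfl

end

theorem lemma5p3 {k : Type*} [Field k] [IsAlgClosed k] [CharZero k]
    {V : Type*} [Quiver V] [Fintype V] [DecidableEq V] [∀ i j : V, Fintype (i ⟶ j)]
    (hconn : Quiver.IsStronglyConnected (Quiver.Symmetrify V))
    (s : ℕ) (hs : 3 ≤ s)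
    (σ : PathAlgebra k V ≃ₐ[k] PathAlgebra k V)
    (hσ : ∀ i : V, σ (PathAlgebra.idem k i) = PathAlgebra.idem k i)
    (ω : PathAlgebra k V) (hω : PathAlgebra.IsTwistedSuperpotential σ s ω)
    (S₁ S₂ : Set (Quiver.Total V)) (hS₁ : S₁.Nonempty) (hS₂ : S₂.Nonempty)
    (hdisj : Disjoint S₁ S₂) (hcover : S₁ ∪ S₂ = Set.univ)
    (hcycle : ∀ (i : V) (p : Quiver.Path i i), p.length = s →
      (∀ a ∈ p.arrowList, a ∈ S₁) ∨ (∀ a ∈ p.arrowList, a ∈ S₂)) :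
    (∃ n ≤ s, PowerSeries.coeff n (PathAlgebra.hilbertSeries (PathAlgebra.derivIdeal ω)) ≠
        PowerSeries.coeff n (typeSeries (incidenceMatrix V) s)) ∧
      ¬ TwistedCY.IsTwistedCalabiYau k (PathAlgebra.DerivationQuotient ω) 3 := by
  have hdiag : ∀ i j : V, i ≠ j → ω i j = 0 := fun i j h => by
    rw [← hω.2]
    exact PathAlgebra.rotate_apply_ne hσ ω h
  have hcycle' : ∀ (i : V) (p : Quiver.Path i i), p.length = s →
      (∀ a ∈ p.arrowList, a ∈ S₁) ∨ (∀ a ∈ p.arrowList, a ∉ S₁) := fun i p hp =>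
    (hcycle i p hp).imp id fun h a ha hn => Set.disjoint_left.1 hdisj hn (h a ha)
  obtain ⟨a₀, ha₀⟩ := hS₁
  obtain ⟨b₀, hb₀⟩ := hS₂
  obtain ⟨i, a, b, ha, hai, hb, hbi⟩ := Quiver.exists_incident_mem_and_notMem hconn S₁ ha₀
    (Set.disjoint_right.1 hdisj hb₀)
  refine ⟨?_, fun h => ?_⟩
  · by_contra! hcoeff
    have hli := PathAlgebra.linearIndependent_relation hs hω.1 hdiag (hcoeff (s - 1) (by omega))
    obtain ⟨l, a', ha'⟩ := PathAlgebra.exists_outgoing hσ hω hli S₁ hcycle' a hai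
    obtain ⟨m, b', hb'⟩ := PathAlgebra.exists_outgoing hσ hω hli S₁ hcycle' b hbi
    exact PathAlgebra.false_of_outgoing hσ hs hω hdiag hli (hcoeff s le_rfl) S₁ hcycle' a' b'
      (ha'.2 ha) fun h => hb (hb'.1 h)
  · exact PathAlgebra.not_subsingleton_ext_one hs hω.1 hdiag S₁ hcycle' ha hai hb hbi
      (h.2.1 1 (by norm_num))
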